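/- Let $\mathbb{G}$ be a Carnot group of step $s$ with stratified Lie algebra $\mathfrak g=V_1\oplus\dots\oplus V_s$ (so $[V_1,V_k]=V_{k+1}$ for $1\le k<s$, $[V_1,V_s]=0$, $V_s\neq 0$), identified with $\mathfrak g$ through the exponential map, the product being given by the Campbell–Hausdorff formula. Fix a basis of $\mathfrak g$ adapted to the layers and let $|g_i|$ be the Euclidean norm of the component of $g$ in $V_i$. Endow $\mathbb{G}$ with the metric $d(x,y)=\lVert x^{-1}y\rVert$, $\lVert g\rVert=\max_i \epsilon_i|g_i|^{1/i}$, where $\epsilon_1=1$ and $\epsilon_2,\dots,\epsilon_s>0$ are such that $d$ is a metric. Let $B(x,r)$ be the open balls and let $\mathcal Q=\sum_i i\dim V_i$. Let $m>0$, let $K\subseteq\mathbb{G}$ be compact and let $\phi$ be a Radon measure on $\mathbb{G}$ with $\phi(\mathbb{G}\setminus K)=0$ such that $$0<\liminf_{r\to0}\frac{\phi(B(x,r))}{r^m}\le\limsup_{r\to0}\frac{\phi(B(x,r))}{r^m}<\infty\quad\text{for }\phi\text{-a.e. }x .$$ For positive integers $\xi,\tau$ put $$E(\xi,\tau)=\{x\in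 K:\ \xi^{-1}r^m\le\phi(B(x,r))\le\xi r^m\ \text{ for all } 0<r<1/\tau\},$$ $$\zeta=2^{-50\mathcal Q}\xi^{-2},\qquad N=\lfloor-4\log\zeta\rfloor+40,\qquad C=2^{24\mathcal Q}\xi$$ (natural logarithm), and for $A\subseteq K$, $\delta>0$ let $$\partial(A,\delta)=\{u\in A:\operatorname{dist}(u,K\setminus A)\le\delta\}\cup\{u\in K\setminus A:\operatorname{dist}(u,A)\le\delta\},$$ where $\operatorname{dist}(u,\emptyset)=\infty$. Suppose $\xi,\tau\ge1$ are integers with $\phi(E(\xi,\tau))>0$. Then for every integer $j\ge1$ there is a partition $\Delta_j$ of $K$ into non-empty, pairwise disjoint Borel sets such that: 1. if $1\le j\le j'$, $Q\in\Delta_j$ and $Q'\in\Delta_{j'}$, then either $Q'\subseteq Q$ or $Q\cap Q'=\emptyset$; 2. $\operatorname{diam}Q\le 2^{-Nj+5}/\tau$ for every $Q\in\Delta_j$; 3. if $Q\in\Delta_j$ and $Q\cap E(\xi,\tau)\ne\emptyset$, then $C^{-1}(2^{-Nj}/\tau)^m\le\phi(Q)\le C(2^{-Nj}/\tau)^m$;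 4. if $Q\in\Delta_j$ contains a point $x$ with $\phi(B(x,r))\le\xi r^m$ for all $0<r<1/\tau$ (in particular if $Q\cap E(\xi,\tau)\neq\emptyset$), then $\phi\big(\partial(Q,\zeta^22^{-Nj}/\tau)\big)\le C\zeta(2^{-Nj}/\tau)^m$; 5. if $Q\in\Delta_j$ and $Q\cap E(\xi,\tau)\ne\emptyset$, there is $c\in K$ with $B(c,\zeta^22^{-Nj-1}/\tau)\cap K\subseteq Q$. -/

import Mathlib

open MeasureTheory Filter Topology
open scoped ENNReal

noncomputable section

namespace Carnot

/-! ### The Baker-Campbell-Hausdorff product -/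

section BCH

variable {𝔤 : Type*} [LieRing 𝔤]

/-- The right-nested bracket `[a₁, [a₂, [… , [aₙ₋₁, aₙ]]]]` of a word. -/
def nestedBracket : List 𝔤 → 𝔤
  | [] => 0
  | [a] => a
  | a :: b :: l => ⁅a, nestedBracket (b :: l)⁆

/-- The word `x^{r₁} y^{s₁} ⋯ x^{r_k} y^{s_k}` attached to `p = ((r₁, s₁), …, (r_k, s_k))`. -/
def bchWord (x y : 𝔤) (p : List (ℕ × ℕ)) : List 𝔤 :=
  p.flatMap fun q => List.replicate q.1 x ++ List.replicate q.2 y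

/-- The Campbell-Hausdorff series `log (eˣ eʸ)` in Dynkin's form, truncated after the brackets of
length `s`:
`∑_k (-1)^(k-1)/k ∑_{r_i + s_i > 0} [x^{r₁} y^{s₁} ⋯ x^{r_k} y^{s_k}] / (∑ (r_i + s_i) ∏ r_i! s_i!)`.
In a Lie algebra that is nilpotent of step `s` it is the full series. -/
def bch [LieAlgebra ℝ 𝔤] (s : ℕ) (x y : 𝔤) : 𝔤 :=
  ∑ k ∈ Finset.Icc 1 s,
    ∑ p : Fin k → Fin (s + 1) × Fin (s + 1) with
        (∀ i, 0 < ((p i).1 : ℕ) + ((p i).2 : ℕ)) ∧ ∑ i, (((p i).1 : ℕ) + ((p i).2 : ℕ)) ≤ s,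
      (((-1 : ℝ) ^ (k - 1) / (k : ℝ)) *
          (((∑ i, (((p i).1 : ℕ) + ((p i).2 : ℕ)) : ℕ) : ℝ) *
            ((∏ i, (Nat.factorial (p i).1 * Nat.factorial (p i).2) : ℕ) : ℝ))⁻¹) •
        nestedBracket (bchWord x y (List.ofFn fun i => (((p i).1 : ℕ), ((p i).2 : ℕ))))

end BCH

/-! ### Carnot groups -/

section Groups

variable {𝔤 : Type*} [LieRing 𝔤] [LieAlgebra ℝ 𝔤] {s : ℕ} {dim : Fin s → ℕ}

/-- The `k`-th layer `V_k` spanned by the `k`-th block of a basis (blocks are numbered from `1`, so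
block `i : Fin s` spans `V_{i+1}`); it is trivial unless `1 ≤ k ≤ s`. -/
def layer (b : Module.Basis ((i : Fin s) × Fin (dim i)) ℝ 𝔤) (k : ℕ) : Submodule ℝ 𝔤 :=
  Submodule.span ℝ {v | ∃ (i : Fin s) (l : Fin (dim i)), (i : ℕ) + 1 = k ∧ v = b ⟨i, l⟩}

/-- The Euclidean norm `|g_{i+1}|` of the component of `g` in the layer `V_{i+1}`. -/
def layerNorm (b : Module.Basis ((i : Fin s) × Fin (dim i)) ℝ 𝔤) (i : Fin s) (g : 𝔤) : ℝ :=
  Real.sqrt (∑ l : Fin (dim i), (b.repr g ⟨i, l⟩) ^ 2)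

/-- The smooth-box norm `max {ε₁ |g₁|, ε₂ |g₂|^(1/2), …, ε_s |g_s|^(1/s)}`. -/
def boxNorm (b : Module.Basis ((i : Fin s) × Fin (dim i)) ℝ 𝔤) (ε : Fin s → ℝ) (g : 𝔤) : ℝ :=
  ⨆ i : Fin s, ε i * layerNorm b i g ^ (1 / (((i : ℕ) : ℝ) + 1))

end Groups

/-- `G` is a Carnot group with Lie algebra `𝔤`, endowed with a smooth-box metric.

The Lie algebra is stratified: `𝔤 = V₁ ⊕ ⋯ ⊕ V_s`, `[V₁, V_k] = V_{k+1}` for `1 ≤ k < s`,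
`[V₁, V_s] = 0` and `V_s ≠ 0`, the layers being given by a basis adapted to them. The exponential
map is a bijection, through which the product of `G` is given by the Campbell-Hausdorff formula.
The metric of `G` is `d(p, q) = ‖p⁻¹ q‖` for the smooth-box norm, where `ε₁ = 1` and the remaining
parameters are such that this is a metric. -/
structure CarnotGroup (G 𝔤 : Type*) [Group G] [MetricSpace G] [LieRing 𝔤] [LieAlgebra ℝ 𝔤] where
  /-- The step `s`. -/
  step : ℕ
  step_pos : 0 < step
  /-- The dimensions of the layers. -/
  layerDim : Fin step → ℕ
  layerDim_pos : ∀ i, 0 < layerDim i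
  /-- A basis adapted to the stratification. -/
  basis : Module.Basis ((i : Fin step) × Fin (layerDim i)) ℝ 𝔤
  lie_layer : ∀ k, 1 ≤ k →
    Submodule.span ℝ {v | ∃ x ∈ layer basis 1, ∃ y ∈ layer basis k, v = ⁅x, y⁆} =
      layer basis (k + 1)
  /-- The exponential map. -/
  exp : 𝔤 ≃ G
  exp_mul_exp : ∀ x y, exp x * exp y = exp (bch step x y)
  /-- The parameters of the smooth-box norm. -/
  eps : Fin step → ℝ
  eps_pos : ∀ i, 0 < eps i
  eps_first : eps ⟨0, step_pos⟩ = 1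
  dist_eq : ∀ p q : G, dist p q = boxNorm basis eps (exp.symm (p⁻¹ * q))

/-- The homogeneous dimension `𝒬 = ∑ i dim V_i`. -/
def CarnotGroup.homDim {G 𝔤 : Type*} [Group G] [MetricSpace G] [LieRing 𝔤] [LieAlgebra ℝ 𝔤]
    (C : CarnotGroup G 𝔤) : ℕ :=
  ∑ i : Fin C.step, ((i : ℕ) + 1) * C.layerDim i

/-! ### Densities -/

section Measures

variable {X : Type*} [MetricSpace X] [MeasurableSpace X]

/-- The lower `m`-density of `φ` at `x`. -/
def lowerDensity (φ : Measure X) (m : ℝ) (x : X) : ℝ≥0∞ :=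
  liminf (fun r : ℝ => φ (Metric.ball x r) / ENNReal.ofReal (r ^ m)) (𝓝[>] 0)

/-- The upper `m`-density of `φ` at `x`. -/
def upperDensity (φ : Measure X) (m : ℝ) (x : X) : ℝ≥0∞ :=
  limsup (fun r : ℝ => φ (Metric.ball x r) / ENNReal.ofReal (r ^ m)) (𝓝[>] 0)

/-- `φ(B(x, r)) ≤ ξ r^m` for all `0 < r < 1/τ`. -/
def UpperRegularAt (φ : Measure X) (m : ℝ) (ξ τ : ℕ) (x : X) : Prop :=
  ∀ r : ℝ, 0 < r → r < 1 / (τ : ℝ) → φ (Metric.ball x r) ≤ ENNReal.ofReal (ξ * r ^ m)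

/-- `φ(B(x, r)) ≥ ξ⁻¹ r^m` for all `0 < r < 1/τ`. -/
def LowerRegularAt (φ : Measure X) (m : ℝ) (ξ τ : ℕ) (x : X) : Prop :=
  ∀ r : ℝ, 0 < r → r < 1 / (τ : ℝ) → ENNReal.ofReal ((ξ : ℝ)⁻¹ * r ^ m) ≤ φ (Metric.ball x r)

/-- The set `E^φ(ξ, τ)` of the points `x ∈ K` such that `ξ⁻¹ r^m ≤ φ(B(x, r)) ≤ ξ r^m` for all
`0 < r < 1/τ`. -/
def regularSet (φ : Measure X) (K : Set X) (m : ℝ) (ξ τ : ℕ) : Set X :=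
  {x | x ∈ K ∧ LowerRegularAt φ m ξ τ x ∧ UpperRegularAt φ m ξ τ x}

end Measures

/-! ### Partitions and boundary layers -/

/-- `Δ` is a partition of `K` into non-empty pairwise disjoint sets. -/
structure IsPartitionOf {X : Type*} (Δ : Set (Set X)) (K : Set X) : Prop where
  nonempty : ∀ Q ∈ Δ, Q.Nonempty
  disjoint : ∀ Q ∈ Δ, ∀ Q' ∈ Δ, Q ≠ Q' → Disjoint Q Q'
  sUnion_eq : ⋃₀ Δ = K

/-- The boundary layer
`∂(A, δ) = {u ∈ A : dist(u, K ∖ A) ≤ δ} ∪ {u ∈ K ∖ A : dist(u, A) ≤ δ}` of `A` relative to `K`;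
the distance from the empty set is infinite. -/
def boundaryLayer {X : Type*} [MetricSpace X] (K A : Set X) (δ : ℝ) : Set X :=
  {u | u ∈ A ∧ Metric.infEDist u (K \ A) ≤ ENNReal.ofReal δ} ∪
    {u | u ∈ K \ A ∧ Metric.infEDist u A ≤ ENNReal.ofReal δ}

/-! ### Constants -/

/-- `ζ = 2^(-50 𝒬) ξ⁻²`. -/
def zeta (Q ξ : ℕ) : ℝ := ((2 : ℝ) ^ (50 * Q))⁻¹ * ((ξ : ℝ) ^ 2)⁻¹

/-- `N = ⌊-4 log ζ⌋ + 40`. -/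
def bigN (Q ξ : ℕ) : ℕ := ⌊-4 * Real.log (zeta Q ξ)⌋₊ + 40

/-- `C = 2^(24 𝒬) ξ`. -/
def cubeConst (Q ξ : ℕ) : ℝ := (2 : ℝ) ^ (24 * Q) * ξ

/-- The scale `2^(-N j) / τ` of the `j`-th generation. -/
def scale (Q ξ τ j : ℕ) : ℝ := ((2 : ℝ) ^ (bigN Q ξ * j))⁻¹ / τ

end Carnot

end

/-! At each scale `l n`, a finite labelling `f n` of the space is made from balls of radius
comparable to `l n`, so that two points get different labels only if the sphere of some ball comes
between them. By pigeonhole the radii can be chosen so that a thin annulus about each sphere carries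
at most `ζ` times the measure of a larger concentric ball (`exists_small_annulus`).

These labellings are not nested. A point receives the label of the label of the label ..., started
from ever finer scales; as each range is finite, a König-type argument gives limit labels with `g n
u = f n (g (n + 1) u)` (`exists_coherent_labelling`). The cubes are the level sets of `g n` in `K`,
nested because `g n` factors through `g (n + k)`. The point `g (n + 1) u` lies within `6 * l (n +
1)` of `u`, and `N` is so large that this is below `ζ ^ 2 * l n`. So the boundary layer of a cube
lies in the thin annuli of its own scale, and only boundedly many of these are near the cube.

For cubes meeting the regular set `E`, the balls centred at a net of `E` get priority: such a cube
is labelled by a point of `E` and contains a ball about it (`exists_scale_labelling`). Regularity at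
that centre bounds its measure from below.

The group enters only through `CarnotGroup.hasPackingGrowth`. In exponential coordinates left
translations are triangular, hence preserve Lebesgue measure, and dilations scale it by `r ^ 𝒬`; so
balls have volume proportional to `r ^ 𝒬`. Packing also forces `m ≤ 𝒬` (`exponent_le`), which lets
powers such as `32 ^ m` be absorbed into `2 ^ (24 * 𝒬)`. -/

namespace Carnot

/-! ### Measurable selections and inverse limits of finite labellings. -/

section Labelling

variable {X : Type*}

/-- A finite family of measurable sets that covers the space admits a measurable selection. -/
theorem exists_measurable_selection [MeasurableSpace X] {S : Set X} (hS : S.Finite)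
    {A : X → Set X} (hA : ∀ i ∈ S, MeasurableSet (A i)) (hcov : ∀ u, ∃ i ∈ S, u ∈ A i) :
    ∃ g : X → X, Measurable g ∧ (∀ u, g u ∈ S) ∧ ∀ u, u ∈ A (g u) := by
  classical
  rcases isEmpty_or_nonempty X with hX | ⟨⟨x₀⟩⟩
  · exact ⟨id, measurable_id, fun u => hX.elim u, fun u => hX.elim u⟩
  have hSne : S.Nonempty := let ⟨i, hi, _⟩ := hcov x₀; ⟨i, hi⟩
  obtain ⟨e, he⟩ := hS.countable.exists_eq_range hSne
  have hmem : ∀ n, e n ∈ S := fun n => he ▸ Set.mem_range_self n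
  have hex : ∀ u, ∃ n, u ∈ A (e n) := by
    intro u
    obtain ⟨i, hi, hu⟩ := hcov u
    rw [he] at hi
    obtain ⟨n, rfl⟩ := hi
    exact ⟨n, hu⟩
  refine ⟨fun u => e (Nat.find (hex u)), ?_, fun u => hmem _, fun u => Nat.find_spec (hex u)⟩
  exact (measurable_from_nat (f := e)).comp (measurable_find hex fun k => hA _ (hmem k))

/-- The composition `f n ∘ f (n + 1) ∘ ⋯ ∘ f (n + d)`. -/
def ancestor (f : ℕ → X → X) : ℕ → ℕ → X → X
  | 0, n => f n
  | d + 1, n => f n ∘ ancestor f d (n + 1)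

/-- A measurable König lemma. The value `g n u` is chosen among the labels that recur for infinitely
many depths `d`; recurrence is a limsup condition, hence measurable, and it can always be continued
to the next generation by pigeonhole. -/
theorem exists_coherent_labelling [MeasurableSpace X] [MeasurableSingletonClass X]
    (f : ℕ → X → X) (hf : ∀ n, Measurable (f n)) (hfin : ∀ n, (Set.range (f n)).Finite) :
    ∃ g : ℕ → X → X, (∀ n, Measurable (g n)) ∧ (∀ n u, g n u = f n (g (n + 1) u)) ∧
      ∀ n u, ∃ d, g n u = ancestor f d n u := by
  have hP : ∀ d n, Measurable (ancestor f d n) := by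
    intro d
    induction d with
    | zero => exact hf
    | succ d ih => exact fun n => (hf n).comp (ih (n + 1))
  have hR : ∀ d n u, ancestor f d n u ∈ Set.range (f n) := by
    intro d n u
    cases d with
    | zero => exact ⟨u, rfl⟩
    | succ d => exact ⟨_, rfl⟩
  have hfreq : ∀ n i, MeasurableSet {u | ∃ᶠ d in atTop, ancestor f d n u = i} := by
    intro n i
    have : {u | ∃ᶠ d in atTop, ancestor f d n u = i} =
        ⋂ a : ℕ, ⋃ b : ℕ, ⋃ _ : a ≤ b, {u | ancestor f b n u = i} := by
      ext u
      simp [frequently_atTop]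
    rw [this]
    exact MeasurableSet.iInter fun a => MeasurableSet.iUnion fun b => MeasurableSet.iUnion
      fun _ => hP b n (measurableSet_singleton i)
  have hpig : ∀ n u (p : X → Prop), (∃ᶠ d in atTop, p (ancestor f d n u)) →
      ∃ i ∈ Set.range (f n), p i ∧ ∃ᶠ d in atTop, ancestor f d n u = i := by
    intro n u p hp
    by_contra! hcon
    have h1 : ∀ i ∈ Set.range (f n), ∀ᶠ d in atTop, p i → ancestor f d n u ≠ i := by
      intro i hi
      by_cases hpi : p i
      · filter_upwards [hcon i hi hpi] with d hd _ using hd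
      · exact Eventually.of_forall fun d h => absurd h hpi
    obtain ⟨d, hd, hd'⟩ := (hp.and_eventually ((hfin n).eventually_all.2 h1)).exists
    exact hd' _ (hR d n u) hd rfl
  let T : ℕ → (X → X) → Prop := fun n g => Measurable g ∧
    ∀ u, ∃ᶠ d in atTop, ancestor f d n u = g u
  have h0 : ∃ g, T 0 g := by
    obtain ⟨g, hg, -, hgA⟩ := exists_measurable_selection (hfin 0)
      (A := fun i => {u | ∃ᶠ d in atTop, ancestor f d 0 u = i}) (fun i _ => hfreq 0 i) (fun u => by
        obtain ⟨i, hi, -, h⟩ := hpig 0 u (fun _ => True)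
          (Eventually.of_forall fun _ => trivial).frequently
        exact ⟨i, hi, h⟩)
    exact ⟨g, hg, hgA⟩
  have hstep : ∀ n g, T n g → ∃ g', T (n + 1) g' ∧ ∀ u, g u = f n (g' u) := by
    rintro n g ⟨hg, hgT⟩
    obtain ⟨g', hg', -, hgA⟩ := exists_measurable_selection (hfin (n + 1))
      (A := fun i => {u | g u = f n i} ∩ {u | ∃ᶠ d in atTop, ancestor f d (n + 1) u = i})
      (fun i _ => (hg (measurableSet_singleton (f n i))).inter (hfreq (n + 1) i)) (fun u => by
        -- Dropping depth `0` keeps recurrence, and depth `d + 1` from `n` is `f n` applied to depth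
        -- `d` from `n + 1`.
        have h1 : ∃ᶠ d in atTop, ancestor f (d + 1) n u = g u :=
          (frequently_map (m := fun d => d + 1) (f := atTop)
            (P := fun d => ancestor f d n u = g u)).1 (by rw [map_add_atTop_eq_nat]; exact hgT u)
        obtain ⟨i, hi, hpi, h⟩ := hpig (n + 1) u (fun i => g u = f n i)
          (h1.mono fun d hd => hd.symm)
        exact ⟨i, hi, hpi, h⟩)
    exact ⟨g', ⟨hg', fun u => (hgA u).2⟩, fun u => (hgA u).1⟩
  choose F hF using hstep
  obtain ⟨g₀, hg₀⟩ := h0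
  let G : (n : ℕ) → {g // T n g} := fun n => Nat.rec (motive := fun n => {g // T n g}) ⟨g₀, hg₀⟩
    (fun n g => ⟨F n g.1 g.2, (hF n g.1 g.2).1⟩) n
  exact ⟨fun n => (G n).1, fun n => (G n).2.1, fun n => (hF n (G n).1 (G n).2).2,
    fun n u => ((G n).2.2 u).exists.imp fun d hd => hd.symm⟩

end Labelling

/-! ### Nets, ball labellings and thin annuli. -/

section Metric

variable {X : Type*} [MetricSpace X]

/-- Separated sets in balls have at most as many points as in a space of dimension `Q`. -/
def HasPackingGrowth (X : Type*) [MetricSpace X] (Q : ℕ) : Prop :=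
  ∀ (T : Finset X) (x : X) (R r : ℝ), 0 < R → 0 < r → (∀ a ∈ T, dist a x < R) →
    (∀ a ∈ T, ∀ b ∈ T, a ≠ b → r ≤ dist a b) → (T.card : ℝ) * (r / 2) ^ Q ≤ (R + r / 2) ^ Q

theorem HasPackingGrowth.exists_net {Q : ℕ} (h : HasPackingGrowth X Q) {S : Set X}
    (hS : Bornology.IsBounded S) {r : ℝ} (hr : 0 < r) :
    ∃ T : Finset X, ↑T ⊆ S ∧ (∀ a ∈ T, ∀ b ∈ T, a ≠ b → r ≤ dist a b) ∧
      ∀ u ∈ S, ∃ t ∈ T, dist u t < r := by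
  classical
  rcases S.eq_empty_or_nonempty with rfl | ⟨x₀, -⟩
  · exact ⟨∅, by simp⟩
  obtain ⟨R, hR, hSR⟩ := hS.subset_ball_lt 0 x₀
  let P : Finset X → Prop := fun T => ↑T ⊆ S ∧ ∀ a ∈ T, ∀ b ∈ T, a ≠ b → r ≤ dist a b
  -- Packing bounds the cardinality of separated sets, so one of maximal cardinality exists; it is a
  -- net.
  have hbd : BddAbove (Finset.card '' {T | P T}) := by
    refine ⟨⌈(R + r / 2) ^ Q / (r / 2) ^ Q⌉₊, ?_⟩
    rintro _ ⟨T, hT, rfl⟩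
    have h1 := h T x₀ R r hR hr (fun a ha => hSR (hT.1 ha)) hT.2
    exact_mod_cast ((le_div_iff₀ (by positivity)).2 h1).trans (Nat.le_ceil _)
  obtain ⟨T, hT, hTc⟩ := Nat.sSup_mem (s := Finset.card '' {T | P T})
    ⟨0, ∅, by simp [P], by simp⟩ hbd
  refine ⟨T, hT.1, hT.2, fun u hu => ?_⟩
  by_contra! hcon
  have huT : u ∉ T := fun h => absurd (hcon u h) (by simp [hr])
  have hP : P (insert u T) := by
    refine ⟨by simpa [Set.insert_subset_iff] using ⟨hu, hT.1⟩, ?_⟩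
    intro a ha b hb hab
    rcases Finset.mem_insert.1 ha with h1 | h1 <;> rcases Finset.mem_insert.1 hb with h2 | h2
    · exact absurd (h1.trans h2.symm) hab
    · exact h1 ▸ hcon b h2
    · rw [dist_comm, h2]; exact hcon a h1
    · exact hT.2 a h1 b h2 hab
  have := le_csSup hbd ⟨_, hP, rfl⟩
  rw [← hTc, Finset.card_insert_of_notMem huT] at this
  omega

/-- The ball `B(c, ρ)` contains exactly one of the points `u` and `v`. -/
def Separates (c : X) (ρ : ℝ) (u v : X) : Prop :=
  (dist u c < ρ ∧ ρ ≤ dist v c) ∨ (dist v c < ρ ∧ ρ ≤ dist u c)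

/-- Points are labelled with the centre of the first ball that contains them. -/
theorem exists_ball_labelling [MeasurableSpace X] [BorelSpace X] (S : Finset X) (ρ : X → ℝ)
    (f₀ : X → X) (hf₀ : Measurable f₀) :
    ∃ f : X → X, Measurable f ∧ (∀ u, (∀ c ∈ S, ρ c ≤ dist u c) → f u = f₀ u) ∧
      (∀ u, (∃ c ∈ S, dist u c < ρ c) → f u ∈ S ∧ dist u (f u) < ρ (f u)) ∧
      ∀ u v, f u ≠ f v → (∃ c ∈ S, Separates c (ρ c) u v) ∨ f₀ u ≠ f₀ v := by
  classical
  induction S using Finset.induction_on with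
  | empty => exact ⟨f₀, hf₀, by simp, by simp, fun u v h => Or.inr h⟩
  | insert a S ha ih =>
    obtain ⟨f, hf, h0, h1, h2⟩ := ih
    refine ⟨(Metric.ball a (ρ a)).piecewise (fun _ => a) f,
      Measurable.piecewise measurableSet_ball measurable_const hf, ?_, ?_, ?_⟩
    · intro u hu
      rw [Set.piecewise_eq_of_notMem _ _ _ (by simpa using hu a (by simp))]
      exact h0 u fun c hc => hu c (by simp [hc])
    · rintro u ⟨c, hc, huc⟩
      by_cases hua : u ∈ Metric.ball a (ρ a)
      · rw [Set.piecewise_eq_of_mem _ _ _ hua]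
        exact ⟨by simp, hua⟩
      · rw [Set.piecewise_eq_of_notMem _ _ _ hua]
        rcases Finset.mem_insert.1 hc with rfl | hc
        · exact absurd huc hua
        · exact ⟨by simp [(h1 u ⟨c, hc, huc⟩).1], (h1 u ⟨c, hc, huc⟩).2⟩
    · intro u v huv
      by_cases hua : u ∈ Metric.ball a (ρ a) <;> by_cases hva : v ∈ Metric.ball a (ρ a)
      · simp [Set.piecewise_eq_of_mem _ _ _ hua, Set.piecewise_eq_of_mem _ _ _ hva] at huv
      · exact Or.inl ⟨a, by simp, Or.inl ⟨hua, by simpa using hva⟩⟩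
      · exact Or.inl ⟨a, by simp, Or.inr ⟨hva, by simpa using hua⟩⟩
      · rw [Set.piecewise_eq_of_notMem _ _ _ hua, Set.piecewise_eq_of_notMem _ _ _ hva] at huv
        exact (h2 u v huv).imp (fun ⟨c, hc, h⟩ => ⟨c, by simp [hc], h⟩) id

/-- The closed annulus of half-width `w` about the sphere of radius `ρ`. -/
def annulus (c : X) (ρ w : ℝ) : Set X := {u | |dist u c - ρ| ≤ w}

theorem measurableSet_annulus [MeasurableSpace X] [BorelSpace X] (c : X) (ρ w : ℝ) :
    MeasurableSet (annulus c ρ w) :=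
  (isClosed_le (by fun_prop) continuous_const).measurableSet

/-- Pigeonhole among `⌈1 / ζ⌉` disjoint annuli of half-width `w` whose radii are spaced by `3 * w`.
Since `⌈1 / ζ⌉ ≤ 2 / ζ`, the radii stay within `6 * w / ζ` of `a`. -/
theorem exists_small_annulus [MeasurableSpace X] [BorelSpace X] (φ : Measure X) (c : X)
    (a : ℝ) {w ζ : ℝ} (hw : 0 < w) (hζ : 0 < ζ) (hζ1 : ζ ≤ 1) :
    ∃ ρ, a ≤ ρ ∧ ρ ≤ a + 6 * w / ζ ∧
      φ (annulus c ρ w) ≤ ENNReal.ofReal ζ * φ (Metric.ball c (a + 6 * w / ζ + 2 * w)) := by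
  set M := ⌈1 / ζ⌉₊ with hM
  have hM1 : 1 / ζ ≤ M := Nat.le_ceil _
  have hM0 : 0 < M := Nat.ceil_pos.2 (by positivity)
  have hM2 : (M : ℝ) ≤ 2 / ζ := by
    have := Nat.ceil_lt_add_one (a := 1 / ζ) (by positivity)
    have h1 : 1 ≤ 1 / ζ := by rw [le_div_iff₀ hζ]; linarith
    rw [show 2 / ζ = 1 / ζ + 1 / ζ by ring]
    linarith
  let A : ℕ → Set X := fun i => annulus c (a + 3 * w * i) w
  have hle : ∀ i ∈ Finset.range M, a + 3 * w * i ≤ a + 6 * w / ζ := by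
    intro i hi
    have : (i : ℝ) ≤ M := by exact_mod_cast (Finset.mem_range.1 hi).le
    have : 3 * w * i ≤ 3 * w * (2 / ζ) := by gcongr; linarith
    calc a + 3 * w * i ≤ a + 3 * w * (2 / ζ) := by linarith
      _ = _ := by ring
  obtain ⟨i, hi, hmin⟩ := Finset.exists_min_image (Finset.range M) (fun i => φ (A i))
    ⟨0, by simpa using hM0⟩
  refine ⟨a + 3 * w * i, by nlinarith [hw, Nat.cast_nonneg (α := ℝ) i], hle i hi, ?_⟩
  have hdisj : Set.PairwiseDisjoint (↑(Finset.range M)) A := by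
    intro i _ k _ hik
    rw [Function.onFun, Set.disjoint_left]
    intro u hu hu'
    have h1 := abs_le.1 (show |dist u c - (a + 3 * w * i)| ≤ w from hu)
    have h2 := abs_le.1 (show |dist u c - (a + 3 * w * k)| ≤ w from hu')
    rcases lt_or_gt_of_ne hik with h | h
    · have : (i : ℝ) + 1 ≤ k := by exact_mod_cast h
      nlinarith
    · have : (k : ℝ) + 1 ≤ i := by exact_mod_cast h
      nlinarith
  have hsum : (M : ℝ≥0∞) * φ (A i) ≤ φ (Metric.ball c (a + 6 * w / ζ + 2 * w)) := by
    calc (M : ℝ≥0∞) * φ (A i) = ∑ k ∈ Finset.range M, φ (A i) := by simp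
      _ ≤ ∑ k ∈ Finset.range M, φ (A k) := Finset.sum_le_sum hmin
      _ = φ (⋃ k ∈ Finset.range M, A k) :=
        (measure_biUnion_finset hdisj fun k _ => measurableSet_annulus _ _ _).symm
      _ ≤ _ := by
        refine measure_mono (Set.iUnion₂_subset fun k hk u hu => ?_)
        have h1 := abs_le.1 (show |dist u c - (a + 3 * w * k)| ≤ w from hu)
        have h2 := hle k hk
        rw [Metric.mem_ball]
        linarith
  calc φ (A i) = ENNReal.ofReal (ζ * (1 / ζ)) * φ (A i) := by
        rw [mul_one_div_cancel hζ.ne']; simp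
    _ ≤ ENNReal.ofReal (ζ * M) * φ (A i) := by gcongr
    _ = ENNReal.ofReal ζ * (M * φ (A i)) := by
        rw [ENNReal.ofReal_mul hζ.le, ENNReal.ofReal_natCast, mul_assoc]
    _ ≤ _ := by gcongr

/-- A point near two points that are separated by a ball lies near the boundary of the ball. -/
theorem mem_annulus_of_separates {c p q u : X} {ρ w : ℝ} (h : Separates c ρ p q)
    (hp : dist p u ≤ w) (hq : dist q u ≤ w) : u ∈ annulus c ρ w := by
  have h1 := dist_triangle p u c
  have h2 := dist_triangle q u c
  have h3 := dist_triangle_left u c p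
  have h4 := dist_triangle_left u c q
  change |dist u c - ρ| ≤ w
  rw [abs_le]
  rcases h with h | h <;> constructor <;> linarith [h.1, h.2]

/-- The displacements sum like a geometric series, `3 * (1 + 1/2 + ⋯) = 6`, uniformly in the depth.
-/
theorem dist_ancestor_le {f : ℕ → X → X} {K : Set X} {l : ℕ → ℝ} (hl : ∀ n, 0 < l n)
    (hl2 : ∀ n, 2 * l (n + 1) ≤ l n) (hfK : ∀ n u, f n u ∈ K)
    (hf : ∀ n, ∀ u ∈ K, dist u (f n u) < 3 * l n) (d n : ℕ) {u : X} (hu : u ∈ K) :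
    ancestor f d n u ∈ K ∧ dist u (ancestor f d n u) ≤ 6 * l n := by
  induction d generalizing n with
  | zero => exact ⟨hfK n u, (hf n u hu).le.trans (by linarith [hl n])⟩
  | succ d ih =>
    refine ⟨hfK n _, ?_⟩
    have h1 := hf n _ (ih (n + 1)).1
    have h2 := dist_triangle u (ancestor f d (n + 1) u) (ancestor f (d + 1) n u)
    have h3 : ancestor f (d + 1) n u = f n (ancestor f d (n + 1) u) := rfl
    rw [← h3] at h1
    linarith [(ih (n + 1)).2, hl2 n]

end Metric

/-! ### Construction of the cubes from packing growth alone. -/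

section Cubes

variable {X : Type*} [MetricSpace X] [MeasurableSpace X]

/-- Three families of balls in decreasing priority. Balls of radius in `[l/4, l/2]` about a net `A`
of `E` are disjoint and protect the cores; balls of radius in `[2l, 9l/4]` about `A` capture all
points near `E`; balls of radius in `[l, 5l/4]` about a net `B` of `K` take the rest of `K`. -/
theorem exists_scale_labelling [BorelSpace X] {Q : ℕ} (hX : HasPackingGrowth X Q) (φ : Measure X) {K E : Set X}
    (hK : Bornology.IsBounded K) (hKne : K.Nonempty) (hEK : E ⊆ K) {l w ζ : ℝ} (hl : 0 < l)
    (hw : 0 < w) (hζ : 0 < ζ) (hζ1 : ζ ≤ 1) (hwl : 6 * w / ζ + 2 * w ≤ l / 4) :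
    ∃ (f : X → X) (A B : Finset X) (ρ : Fin 3 → X → ℝ),
      Measurable f ∧ (Set.range f).Finite ∧ (∀ u, f u ∈ K) ∧ ↑A ⊆ E ∧
      (∀ a ∈ A, ∀ b ∈ A, a ≠ b → l ≤ dist a b) ∧ (∀ a ∈ B, ∀ b ∈ B, a ≠ b → l ≤ dist a b) ∧
      (∀ u ∈ K, dist u (f u) < 3 * l) ∧
      (∀ u, ∀ x ∈ E, dist u x < l / 4 → f u ∈ A) ∧
      (∀ c ∈ A, ∀ u, dist u c < l / 4 → f u = c) ∧
      (∀ i c, ρ i c ≤ 3 * l ∧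
        φ (annulus c (ρ i c) w) ≤ ENNReal.ofReal ζ * φ (Metric.ball c (3 * l))) ∧
      ∀ u ∈ K, ∀ v ∈ K, f u ≠ f v →
        ∃ i, (∃ c ∈ A, Separates c (ρ i c) u v) ∨ ∃ c ∈ B, Separates c (ρ i c) u v := by
  classical
  obtain ⟨x₀, hx₀⟩ := hKne
  obtain ⟨A, hAE, hAsep, hAnet⟩ := hX.exists_net (hK.subset hEK) hl
  obtain ⟨B, hBK, hBsep, hBnet⟩ := hX.exists_net hK hl
  have hrad : ∀ a, a ≤ 2 * l → ∃ ρ : X → ℝ, ∀ c, a ≤ ρ c ∧ ρ c ≤ a + l / 4 ∧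
      φ (annulus c (ρ c) w) ≤ ENNReal.ofReal ζ * φ (Metric.ball c (3 * l)) := by
    intro a ha
    choose ρ h1 h2 h3 using fun c => exists_small_annulus φ c a hw hζ hζ1
    refine ⟨ρ, fun c => ⟨h1 c, by linarith [h2 c], (h3 c).trans ?_⟩⟩
    gcongr
    linarith
  obtain ⟨ρ₀, hρ₀⟩ := hrad (l / 4) (by linarith)
  obtain ⟨ρ₁, hρ₁⟩ := hrad (2 * l) le_rfl
  obtain ⟨ρ₂, hρ₂⟩ := hrad l (by linarith)
  obtain ⟨f₂, hf₂, hf₂out, hf₂in, hf₂sep⟩ :=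
    exists_ball_labelling B ρ₂ (fun _ => x₀) measurable_const
  obtain ⟨f₁, hf₁, hf₁out, hf₁in, hf₁sep⟩ := exists_ball_labelling A ρ₁ f₂ hf₂
  obtain ⟨f, hf, hfout, hfin, hfsep⟩ := exists_ball_labelling A ρ₀ f₁ hf₁
  have key : ∀ u, (f u ∈ A ∧ dist u (f u) < ρ₀ (f u)) ∨
      ((∀ c ∈ A, ρ₀ c ≤ dist u c) ∧ f u = f₁ u) := by
    intro u
    by_cases h : ∃ c ∈ A, dist u c < ρ₀ c
    · exact Or.inl (hfin u h)
    · push Not at h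
      exact Or.inr ⟨h, hfout u h⟩
  have key₁ : ∀ u, (f₁ u ∈ A ∧ dist u (f₁ u) < ρ₁ (f₁ u)) ∨
      ((∀ c ∈ A, ρ₁ c ≤ dist u c) ∧ f₁ u = f₂ u) := by
    intro u
    by_cases h : ∃ c ∈ A, dist u c < ρ₁ c
    · exact Or.inl (hf₁in u h)
    · push Not at h
      exact Or.inr ⟨h, hf₁out u h⟩
  have key₂ : ∀ u, (f₂ u ∈ B ∧ dist u (f₂ u) < ρ₂ (f₂ u)) ∨
      ((∀ c ∈ B, ρ₂ c ≤ dist u c) ∧ f₂ u = x₀) := by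
    intro u
    by_cases h : ∃ c ∈ B, dist u c < ρ₂ c
    · exact Or.inl (hf₂in u h)
    · push Not at h
      exact Or.inr ⟨h, hf₂out u h⟩
  have hrange : ∀ u, f u ∈ insert x₀ (A ∪ B) := by
    intro u
    simp only [Finset.mem_insert, Finset.mem_union]
    rcases key u with h | ⟨-, h⟩
    · exact Or.inr (Or.inl h.1)
    rw [h]
    rcases key₁ u with h | ⟨-, h⟩
    · exact Or.inr (Or.inl h.1)
    rw [h]
    rcases key₂ u with h | ⟨-, h⟩
    · exact Or.inr (Or.inr h.1)
    · exact Or.inl h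
  refine ⟨f, A, B, ![ρ₀, ρ₁, ρ₂], hf, ?_, ?_, hAE, hAsep, hBsep, ?_, ?_, ?_, ?_, ?_⟩
  · exact (insert x₀ (A ∪ B)).finite_toSet.subset (by rintro _ ⟨u, rfl⟩; exact hrange u)
  · intro u
    have := hrange u
    simp only [Finset.mem_insert, Finset.mem_union] at this
    rcases this with h | h | h
    · rwa [h]
    · exact hEK (hAE h)
    · exact hBK h
  · intro u hu
    rcases key u with h | ⟨-, h⟩
    · linarith [h.2, (hρ₀ (f u)).2.1]
    rw [h]
    rcases key₁ u with h | ⟨-, h⟩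
    · linarith [h.2, (hρ₁ (f₁ u)).2.1]
    rw [h]
    rcases key₂ u with h | ⟨h, -⟩
    · linarith [h.2, (hρ₂ (f₂ u)).2.1]
    · obtain ⟨t, ht, hut⟩ := hBnet u hu
      linarith [h t ht, (hρ₂ t).1]
  · intro u x hx hux
    rcases key u with h | ⟨-, h⟩
    · exact h.1
    rw [h]
    rcases key₁ u with h | ⟨h, -⟩
    · exact h.1
    · obtain ⟨t, ht, hxt⟩ := hAnet x hx
      linarith [h t ht, (hρ₁ t).1, dist_triangle u x t]
  · intro c hc u huc
    obtain ⟨h1, h2⟩ := hfin u ⟨c, hc, huc.trans_le (hρ₀ c).1⟩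
    by_contra hne
    linarith [hAsep _ h1 _ hc hne, dist_triangle_left (f u) c u, (hρ₀ (f u)).2.1]
  · intro i c
    fin_cases i
    · exact ⟨by show ρ₀ c ≤ _; linarith [(hρ₀ c).2.1], (hρ₀ c).2.2⟩
    · exact ⟨by show ρ₁ c ≤ _; linarith [(hρ₁ c).2.1], (hρ₁ c).2.2⟩
    · exact ⟨by show ρ₂ c ≤ _; linarith [(hρ₂ c).2.1], (hρ₂ c).2.2⟩
  · intro u _ v _ huv
    rcases hfsep u v huv with h | h
    · exact ⟨0, Or.inl h⟩
    rcases hf₁sep u v h with h | h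
    · exact ⟨1, Or.inl h⟩
    rcases hf₂sep u v h with h | h
    · exact ⟨2, Or.inr h⟩
    · exact absurd rfl h

theorem HasPackingGrowth.measure_biUnion_annulus_le {Q : ℕ} (hX : HasPackingGrowth X Q)
    {φ : Measure X} {A : Finset X} {ρ : X → ℝ} {l w ζ : ℝ} (hl : 0 < l)
    (hA : ∀ a ∈ A, ∀ b ∈ A, a ≠ b → l ≤ dist a b)
    (hρ : ∀ c, φ (annulus c (ρ c) w) ≤ ENNReal.ofReal ζ * φ (Metric.ball c (3 * l))) (x : X) :
    φ (⋃ c ∈ A, ⋃ _ : dist c x < 21 * l, annulus c (ρ c) w) ≤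
      64 ^ Q * (ENNReal.ofReal ζ * φ (Metric.ball x (32 * l))) := by
  classical
  have hcard : ((A.filter fun c => dist c x < 21 * l).card : ℝ≥0∞) ≤ 64 ^ Q := by
    have h1 := hX (A.filter fun c => dist c x < 21 * l) x (21 * l) l (by positivity) hl
      (fun a ha => (Finset.mem_filter.1 ha).2)
      (fun a ha b hb => hA a (Finset.mem_filter.1 ha).1 b (Finset.mem_filter.1 hb).1)
    -- The ratio of the radii is `43`.
    have h2 : (21 * l + l / 2) ^ Q ≤ 64 ^ Q * (l / 2) ^ Q := by
      rw [← mul_pow]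
      gcongr
      linarith
    have h3 := le_of_mul_le_mul_right (h1.trans h2) (by positivity)
    exact_mod_cast h3
  calc φ (⋃ c ∈ A, ⋃ _ : dist c x < 21 * l, annulus c (ρ c) w)
      ≤ φ (⋃ c ∈ A.filter (fun c => dist c x < 21 * l), annulus c (ρ c) w) := by
        refine measure_mono (Set.iUnion₂_subset fun c hc => Set.iUnion_subset fun h => ?_)
        exact Set.subset_biUnion_of_mem (u := fun c => annulus c (ρ c) w)
          (Finset.mem_coe.2 (Finset.mem_filter.2 ⟨hc, h⟩))
    _ ≤ ∑ c ∈ A.filter (fun c => dist c x < 21 * l), φ (annulus c (ρ c) w) :=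
        measure_biUnion_finset_le _ _
    _ ≤ ∑ c ∈ A.filter (fun c => dist c x < 21 * l),
          ENNReal.ofReal ζ * φ (Metric.ball x (32 * l)) := by
        refine Finset.sum_le_sum fun c hc => (hρ c).trans ?_
        gcongr
        refine Metric.ball_subset_ball' ?_
        linarith [(Finset.mem_filter.1 hc).2]
    _ ≤ _ := by
        rw [Finset.sum_const, nsmul_eq_mul]
        gcongr

/-- Dyadic cubes in a bounded set `K` of a space with packing growth: all of them have small
boundaries, and those that meet a given subset `E` contain balls centred at points of `E`. -/
theorem HasPackingGrowth.exists_cubes [BorelSpace X] {Q : ℕ} (hX : HasPackingGrowth X Q) (φ : Measure X)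
    {K E : Set X} (hK : Bornology.IsBounded K) (hKm : MeasurableSet K) (hKne : K.Nonempty)
    (hEK : E ⊆ K) {l : ℕ → ℝ} {ζ : ℝ} (hl : ∀ n, 0 < l n) (hζ : 0 < ζ) (hζ1 : ζ ≤ 1 / 96)
    (hlζ : ∀ n, 16 * l (n + 1) ≤ ζ ^ 2 * l n) :
    ∃ Δ : ℕ → Set (Set X),
      (∀ j, IsPartitionOf (Δ j) K ∧ ∀ D ∈ Δ j, MeasurableSet D) ∧
      (∀ j j', j ≤ j' → ∀ D ∈ Δ j, ∀ D' ∈ Δ j', D' ⊆ D ∨ Disjoint D D') ∧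
      (∀ j, ∀ D ∈ Δ j, ∀ u ∈ D, ∀ v ∈ D, dist u v ≤ 12 * l j) ∧
      (∀ j, ∀ D ∈ Δ j, (D ∩ E).Nonempty → ∃ c ∈ E, Metric.ball c (l j / 8) ∩ K ⊆ D) ∧
      ∀ j, ∀ D ∈ Δ j, ∀ x ∈ D, φ (boundaryLayer K D (ζ ^ 2 * l j)) ≤
        6 * 64 ^ Q * (ENNReal.ofReal ζ * φ (Metric.ball x (32 * l j))) := by
  have hζ2 : ζ ^ 2 ≤ ζ / 96 := by nlinarith
  have hl2 : ∀ n, 2 * l (n + 1) ≤ l n := fun n => by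
    have := hlζ n
    nlinarith [hl n, hl (n + 1)]
  -- With `w = 3 * ζ ^ 2 * l n` the radius condition reads `18 * ζ + 6 * ζ ^ 2 ≤ 1 / 4`, which `ζ ≤
  -- 1 / 96` guarantees.
  choose f A B ρ hf hfin hfK hAE hA hB hdist hnear hcore hρ hsep using fun n =>
    exists_scale_labelling hX φ hK hKne hEK (l := l n) (w := 3 * ζ ^ 2 * l n) (hl n)
      (by have := hl n; positivity) hζ (by linarith) (by
        have h1 : 6 * (3 * ζ ^ 2 * l n) / ζ = 18 * ζ * l n := by field_simp; ring
        rw [h1]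
        nlinarith [hl n, mul_pos hζ (hl n)])
  obtain ⟨g, hg, hgf, hganc⟩ := exists_coherent_labelling f hf hfin
  have hgd : ∀ n, ∀ u ∈ K, g n u ∈ K ∧ dist u (g n u) ≤ 6 * l n := by
    intro n u hu
    obtain ⟨d, hd⟩ := hganc n u
    rw [hd]
    exact dist_ancestor_le hl hl2 hfK hdist d n hu
  have hfactor : ∀ j k, ∃ h : X → X, ∀ u, g j u = h (g (j + k) u) := by
    intro j k
    induction k with
    | zero => exact ⟨id, fun u => rfl⟩
    | succ k ih =>
      obtain ⟨h, hh⟩ := ih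
      exact ⟨h ∘ f (j + k), fun u => by rw [hh, hgf]; rfl⟩
  let D : ℕ → X → Set X := fun j c => K ∩ g j ⁻¹' {c}
  have hmemD : ∀ j, ∀ u ∈ K, u ∈ D j (g j u) := fun j u hu => ⟨hu, rfl⟩
  refine ⟨fun j => {S | S.Nonempty ∧ ∃ c, S = D j c}, ?_, ?_, ?_, ?_, ?_⟩
  · refine fun j => ⟨⟨fun S hS => hS.1, ?_, ?_⟩, ?_⟩
    · rintro _ ⟨-, c, rfl⟩ _ ⟨-, c', rfl⟩ hne
      refine Set.disjoint_left.2 fun u hu hu' => hne ?_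
      rw [← show g j u = c from hu.2, ← show g j u = c' from hu'.2]
    · refine Set.Subset.antisymm (Set.sUnion_subset ?_) fun u hu =>
        ⟨D j (g j u), ⟨⟨u, hmemD j u hu⟩, _, rfl⟩, hmemD j u hu⟩
      rintro _ ⟨-, c, rfl⟩
      exact Set.inter_subset_left
    · rintro _ ⟨-, c, rfl⟩
      exact hKm.inter (hg j (measurableSet_singleton c))
  · rintro j j' hjj' _ ⟨-, c, rfl⟩ _ ⟨-, c', rfl⟩
    obtain ⟨k, rfl⟩ := Nat.exists_eq_add_of_le hjj'
    obtain ⟨h, hh⟩ := hfactor j k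
    by_cases hc : h c' = c
    · left
      rintro u ⟨hu, hu'⟩
      refine ⟨hu, ?_⟩
      rw [Set.mem_preimage, hh, show g (j + k) u = c' from hu', hc, Set.mem_singleton_iff]
    · right
      refine Set.disjoint_left.2 fun u hu hu' => hc ?_
      rw [← show g (j + k) u = c' from hu'.2, ← hh, show g j u = c from hu.2]
  · rintro j _ ⟨-, c, rfl⟩ u hu v hv
    have h1 := (hgd j u hu.1).2
    have h2 := (hgd j v hv.1).2
    rw [show g j u = c from hu.2] at h1
    rw [show g j v = c from hv.2] at h2
    linarith [dist_triangle_right u v c]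
  · rintro j _ ⟨-, c, rfl⟩ ⟨x, ⟨hxK, hxc⟩, hxE⟩
    have hclose : ∀ u ∈ K, dist (g (j + 1) u) u ≤ 6 * l (j + 1) ∧ 6 * l (j + 1) < l j / 8 := by
      intro u hu
      refine ⟨by rw [dist_comm]; exact (hgd (j + 1) u hu).2, ?_⟩
      have := hlζ j
      nlinarith [hl j]
    -- The label `c` of the cube is read off from `g (j + 1) x`, which is still close to the point
    -- `x` of `E`.
    have hcA : c ∈ A j := by
      rw [← show g j x = c from hxc, hgf]
      exact hnear j _ x hxE (by linarith [(hclose x hxK).1, (hclose x hxK).2, hl j])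
    refine ⟨c, hAE j hcA, fun u hu => ⟨hu.2, ?_⟩⟩
    rw [Set.mem_preimage, hgf]
    refine hcore j c hcA _ ?_
    linarith [dist_triangle (g (j + 1) u) u c, Metric.mem_ball.1 hu.1, (hclose u hu.2).1,
      (hclose u hu.2).2]
  · rintro j _ ⟨-, c, rfl⟩ x hx
    set δ := ζ ^ 2 * l j with hδ
    have hδ0 : 0 < δ := by have := hl j; positivity
    have hδl : 96 * δ ≤ l j := by
      have := mul_le_mul_of_nonneg_right hζ2 (hl j).le
      nlinarith [hl j]
    have hclose : ∀ u ∈ K, dist (g (j + 1) u) u ≤ δ := by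
      intro u hu
      rw [dist_comm]
      linarith [(hgd (j + 1) u hu).2, hlζ j, hl (j + 1)]
    have hpair : ∀ u ∈ K, ∀ v ∈ K, dist u v < 2 * δ → g j u ≠ g j v → dist u x ≤ 13 * l j →
        u ∈ ⋃ i : Fin 3,
          (⋃ a ∈ A j, ⋃ _ : dist a x < 21 * l j, annulus a (ρ j i a) (3 * ζ ^ 2 * l j)) ∪
          ⋃ a ∈ B j, ⋃ _ : dist a x < 21 * l j, annulus a (ρ j i a) (3 * ζ ^ 2 * l j) := by
      intro u hu v hv huv hne hux
      rw [hgf, hgf j v] at hne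
      have hw : 3 * ζ ^ 2 * l j = 3 * δ := by rw [hδ]; ring
      have h1 := hclose u hu
      -- The sphere separates the displaced points, not `u` and `v`: `δ` for the displacement of `v`
      -- plus `2 * δ` for `dist u v` gives the half-width of the annuli.
      have h2 : dist (g (j + 1) v) u ≤ 3 * δ := by
        linarith [dist_triangle (g (j + 1) v) v u, hclose v hv, dist_comm u v]
      have hfar : ∀ i a, Separates a (ρ j i a) (g (j + 1) u) (g (j + 1) v) →
          dist a x < 21 * l j ∧ u ∈ annulus a (ρ j i a) (3 * ζ ^ 2 * l j) := by
        intro i a ha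
        have h3 : u ∈ annulus a (ρ j i a) (3 * ζ ^ 2 * l j) :=
          mem_annulus_of_separates ha (by linarith) (by linarith)
        refine ⟨?_, h3⟩
        have h4 := (abs_le.1 (show |dist u a - ρ j i a| ≤ _ from h3)).2
        -- The radius, the half-width and `dist u x` add up to at most `3 * l j + 3 * δ + 13 * l j`.
        linarith [dist_triangle_left a x u, (hρ j i a).1, hl j]
      obtain ⟨i, ⟨a, ha, has⟩ | ⟨a, ha, has⟩⟩ := hsep j _ (hgd (j + 1) u hu).1 _
        (hgd (j + 1) v hv).1 hne
      · refine Set.mem_iUnion.2 ⟨i, Or.inl ?_⟩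
        exact Set.mem_iUnion₂.2 ⟨a, ha, Set.mem_iUnion.2 (by simpa using hfar i a has)⟩
      · refine Set.mem_iUnion.2 ⟨i, Or.inr ?_⟩
        exact Set.mem_iUnion₂.2 ⟨a, ha, Set.mem_iUnion.2 (by simpa using hfar i a has)⟩
    have hnearx : ∀ u ∈ D j c, dist u x ≤ 12 * l j := by
      intro u hu
      have h1 := (hgd j u hu.1).2
      have h2 := (hgd j x hx.1).2
      rw [show g j u = c from hu.2] at h1
      rw [show g j x = c from hx.2] at h2
      linarith [dist_triangle_right u x c]
    -- The infimum need not be attained, hence the factor `2`.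
    have hex : ∀ (u : X) (S : Set X), Metric.infEDist u S ≤ ENNReal.ofReal δ →
        ∃ v ∈ S, dist u v < 2 * δ := by
      intro u S h
      obtain ⟨v, hv, huv⟩ := Metric.infEDist_lt_iff.1
        (h.trans_lt ((ENNReal.ofReal_lt_ofReal_iff (by linarith)).2
          (show δ < 2 * δ by linarith)))
      rw [edist_dist, ENNReal.ofReal_lt_ofReal_iff (by linarith)] at huv
      exact ⟨v, hv, huv⟩
    have hsub : boundaryLayer K (D j c) δ ⊆ ⋃ i : Fin 3,
          (⋃ a ∈ A j, ⋃ _ : dist a x < 21 * l j, annulus a (ρ j i a) (3 * ζ ^ 2 * l j)) ∪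
          ⋃ a ∈ B j, ⋃ _ : dist a x < 21 * l j, annulus a (ρ j i a) (3 * ζ ^ 2 * l j) := by
      rintro u (⟨hu, hd⟩ | ⟨hu, hd⟩)
      · obtain ⟨v, hv, huv⟩ := hex u _ hd
        refine hpair u hu.1 v hv.1 huv (fun h => hv.2 ⟨hv.1, ?_⟩) ?_
        · rw [Set.mem_preimage, ← h]; exact hu.2
        · linarith [hnearx u hu, hl j]
      · obtain ⟨v, hv, huv⟩ := hex u _ hd
        refine hpair u hu.1 v hv.1 huv (fun h => hu.2 ⟨hu.1, ?_⟩) ?_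
        · rw [Set.mem_preimage, h]; exact hv.2
        · linarith [hnearx v hv, dist_triangle u v x, hl j]
    have hb : ∀ S : Finset X, (∀ a ∈ S, ∀ b ∈ S, a ≠ b → l j ≤ dist a b) → ∀ i,
        φ (⋃ a ∈ S, ⋃ _ : dist a x < 21 * l j, annulus a (ρ j i a) (3 * ζ ^ 2 * l j)) ≤
          64 ^ Q * (ENNReal.ofReal ζ * φ (Metric.ball x (32 * l j))) := fun S hS i =>
      hX.measure_biUnion_annulus_le (hl j) hS (fun c => (hρ j i c).2) x
    refine (measure_mono hsub).trans ((measure_iUnion_fintype_le φ _).trans ?_)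
    calc _ ≤ ∑ i : Fin 3, (64 ^ Q * (ENNReal.ofReal ζ * φ (Metric.ball x (32 * l j))) +
          64 ^ Q * (ENNReal.ofReal ζ * φ (Metric.ball x (32 * l j)))) :=
        Finset.sum_le_sum fun i _ => (measure_union_le _ _).trans
          (add_le_add (hb _ (hA j) i) (hb _ (hB j) i))
      _ = _ := by
        rw [Finset.sum_const, Finset.card_univ, Fintype.card_fin, nsmul_eq_mul]
        push_cast
        ring

end Cubes

/-! ### Triangular maps preserve Lebesgue measure. -/

section Triangular

variable {ι : Type*} [Fintype ι]

/-- A shear `x ↦ x + f(x)` that changes the coordinates in `{k | p k}` by a function of the other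
coordinates preserves the volume. -/
theorem measurePreserving_shear (p : ι → Prop) [DecidablePred p] {f : (ι → ℝ) → ι → ℝ}
    (hf : Measurable f) (hdep : ∀ x y, (∀ k, ¬ p k → x k = y k) → f x = f y) :
    MeasurePreserving (fun (x : ι → ℝ) k => if p k then x k + f x k else x k) volume volume := by
  have hmp := volume_preserving_piEquivPiSubtypeProd (fun _ : ι => ℝ) (fun k => ¬ p k)
  set e := MeasurableEquiv.piEquivPiSubtypeProd (fun _ : ι => ℝ) (fun k => ¬ p k) with he
  let z : ({k // ¬ p k} → ℝ) → ι → ℝ := fun y => e.symm (y, fun _ => 0)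
  have hz : Measurable z := e.symm.measurable.comp (measurable_id.prodMk measurable_const)
  have hshear : MeasurePreserving
      (fun q : ({k // ¬ p k} → ℝ) × ({k // ¬ ¬ p k} → ℝ) => (q.1, q.2 + fun k : {k // ¬ ¬ p k} => f (z q.1) k))
      (volume.prod volume) (volume.prod volume) := by
    refine (MeasurePreserving.id volume).skew_product
      (g := fun (y : {k // ¬ p k} → ℝ) (t : {k // ¬ ¬ p k} → ℝ) =>
        t + fun k : {k // ¬ ¬ p k} => f (z y) k)
      ?_ (ae_of_all _ fun y => ?_)
    · refine measurable_snd.add (measurable_pi_lambda _ fun k => ?_)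
      exact (measurable_pi_apply (k : ι)).comp (hf.comp (hz.comp measurable_fst))
    · exact (measurePreserving_add_right volume _).map_eq
  have hcomp := (hmp.symm e).comp (hshear.comp hmp)
  suffices h : (fun (x : ι → ℝ) k => if p k then x k + f x k else x k) =
      e.symm ∘ (fun q => (q.1, q.2 + fun k : {k // ¬ ¬ p k} => f (z q.1) k)) ∘ e from h ▸ hcomp
  funext x k
  have hfx : f (z (e x).1) = f x := by
    refine hdep _ _ fun k hk => ?_
    simp [z, he, MeasurableEquiv.piEquivPiSubtypeProd, Equiv.piEquivPiSubtypeProd, hk]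
  by_cases hk : p k
  · simp only [Function.comp_apply, hfx]
    simp [he, MeasurableEquiv.piEquivPiSubtypeProd, Equiv.piEquivPiSubtypeProd, hk]
  · simp [he, MeasurableEquiv.piEquivPiSubtypeProd, Equiv.piEquivPiSubtypeProd, hk]

/-- A map whose `k`-th component is `x k + f x k`, where `f x k` depends only on the coordinates of
smaller weight than `k`, preserves the volume. -/
theorem measurePreserving_of_triangular (w : ι → ℕ) {f : (ι → ℝ) → ι → ℝ} (hf : Measurable f)
    (hdep : ∀ k x y, (∀ q, w q < w k → x q = y q) → f x k = f y k) :
    MeasurePreserving (fun x : ι → ℝ => x + f x) volume volume := by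
  classical
  let F : ℕ → (ι → ℝ) → ι → ℝ := fun n x k => if n ≤ w k then x k + f x k else x k
  obtain ⟨M, hM⟩ : ∃ M, ∀ k, w k < M :=
    ⟨Finset.univ.sup w + 1, fun k => Nat.lt_succ_of_le (Finset.le_sup (Finset.mem_univ k))⟩
  -- The map is a product of shears, the highest weights acting first: `F (n + 1)` leaves weights up
  -- to `n` alone, so the shear at weight `n` still reads the original coordinates.
  have hstep : ∀ n, F n = (fun (x : ι → ℝ) k =>
      if w k = n then x k + (fun j => if w j = n then f x j else 0) k else x k) ∘ F (n + 1) := by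
    intro n
    funext x k
    simp only [Function.comp_apply, F]
    by_cases hk : w k = n
    · simp only [hk, le_refl, if_true, Nat.not_succ_le_self, if_false]
      rw [hdep k _ x fun q hq => if_neg (by omega)]
    · by_cases hk' : n ≤ w k
      · simp [hk, hk', show n + 1 ≤ w k by omega]
      · simp [hk, hk', show ¬ n + 1 ≤ w k by omega]
  have hF : ∀ d n, M ≤ n + d → MeasurePreserving (F n) volume volume := by
    intro d
    induction d with
    | zero =>
      intro n hn
      have : F n = id := by
        funext x k
        exact if_neg (by have := hM k; omega)
      rw [this]
      exact MeasurePreserving.id _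
    | succ d ih =>
      intro n hn
      rw [hstep n]
      refine MeasurePreserving.comp ?_ (ih (n + 1) (by omega))
      refine measurePreserving_shear (fun k => w k = n)
        (f := fun x j => if w j = n then f x j else 0) ?_ ?_
      · refine measurable_pi_lambda _ fun j => ?_
        by_cases hj : w j = n
        · simpa [hj, Function.comp_def] using (measurable_pi_apply j).comp hf
        · simp [hj]
      · intro x y hxy
        funext j
        by_cases hj : w j = n
        · simp only [hj, if_true]
          exact hdep j x y fun q hq => hxy q (by omega)
        · simp [hj]
  have h0 : F 0 = fun x => x + f x := by
    funext x k
    simp [F]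
  exact h0 ▸ hF M 0 (by omega)

end Triangular

/-! ### Campbell-Hausdorff words as functions of one variable. -/

section Words

variable {𝔤 : Type*}

/-- The letters of a Campbell-Hausdorff word as functions of the second variable. -/
def bchLetters (a : 𝔤) (p : List (ℕ × ℕ)) : List (𝔤 → 𝔤) :=
  p.flatMap fun q => List.replicate q.1 (fun _ => a) ++ List.replicate q.2 id

theorem bchWord_eq_map (a x : 𝔤) (p : List (ℕ × ℕ)) :
    bchWord a x p = (bchLetters a p).map fun f => f x := by
  simp [bchWord, bchLetters, List.map_flatMap]

theorem eq_of_mem_bchLetters {a : 𝔤} {p : List (ℕ × ℕ)} {f : 𝔤 → 𝔤} (hf : f ∈ bchLetters a p) :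
    f = (fun _ => a) ∨ f = id := by
  simp only [bchLetters, List.mem_flatMap, List.mem_append, List.mem_replicate] at hf
  obtain ⟨q, -, h | h⟩ := hf
  · exact Or.inl h.2
  · exact Or.inr h.2

theorem length_bchLetters (a : 𝔤) (p : List (ℕ × ℕ)) :
    (bchLetters a p).length = (p.map fun q => q.1 + q.2).sum := by
  simp [bchLetters, List.length_flatMap]

end Words

/-! ### Left translations are triangular for the filtration by layers. -/

section Filtration

variable {𝔤 : Type*} [LieRing 𝔤] [LieAlgebra ℝ 𝔤] {s : ℕ} {dim : Fin s → ℕ}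

/-- The sum of the layers beyond the `n`-th. -/
def tail (b : Module.Basis ((i : Fin s) × Fin (dim i)) ℝ 𝔤) (n : ℕ) : Submodule ℝ 𝔤 where
  carrier := {v | ∀ q, (q.1 : ℕ) + 1 ≤ n → b.repr v q = 0}
  add_mem' := fun hu hv q hq => by simp [hu q hq, hv q hq]
  zero_mem' := fun q _ => by simp
  smul_mem' := fun c v hv q hq => by simp [hv q hq]

theorem tail_anti (b : Module.Basis ((i : Fin s) × Fin (dim i)) ℝ 𝔤) {m n : ℕ} (h : m ≤ n) :
    tail b n ≤ tail b m := fun _ hv q hq => hv q (hq.trans h)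

theorem layer_le_tail (b : Module.Basis ((i : Fin s) × Fin (dim i)) ℝ 𝔤) {n k : ℕ} (h : n < k) :
    layer b k ≤ tail b n := by
  refine Submodule.span_le.2 ?_
  rintro _ ⟨i, l, hi, rfl⟩ q hq
  rw [b.repr_self, Finsupp.single_eq_of_ne]
  rintro rfl
  simp only at hq
  omega

theorem basis_mem_layer (b : Module.Basis ((i : Fin s) × Fin (dim i)) ℝ 𝔤)
    (k : (i : Fin s) × Fin (dim i)) : b k ∈ layer b (k.1 + 1) :=
  Submodule.subset_span ⟨k.1, k.2, rfl, rfl⟩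

variable {b : Module.Basis ((i : Fin s) × Fin (dim i)) ℝ 𝔤}

/-- Only brackets with `V₁` are given; the general case follows by induction on `i` from the Jacobi
identity. -/
theorem lie_mem_layer
    (hb : ∀ k, 1 ≤ k → Submodule.span ℝ {v | ∃ x ∈ layer b 1, ∃ y ∈ layer b k, v = ⁅x, y⁆} =
      layer b (k + 1)) {i j : ℕ} (hi : 1 ≤ i) (hj : 1 ≤ j) {x y : 𝔤} (hx : x ∈ layer b i)
    (hy : y ∈ layer b j) : ⁅x, y⁆ ∈ layer b (i + j) := by
  induction i, hi using Nat.le_induction generalizing j x y with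
  | base =>
    rw [add_comm, ← hb j hj]
    exact Submodule.subset_span ⟨x, hx, y, hy, rfl⟩
  | succ i hi ih =>
    rw [← hb i hi] at hx
    induction hx using Submodule.span_induction with
    | mem x hx =>
      obtain ⟨a, ha, c, hc, rfl⟩ := hx
      have hone : ∀ k, 1 ≤ k → ∀ v ∈ layer b k, ⁅a, v⁆ ∈ layer b (k + 1) := fun k hk v hv => by
        rw [← hb k hk]
        exact Submodule.subset_span ⟨a, ha, v, hv, rfl⟩
      rw [lie_lie]
      refine Submodule.sub_mem _ ?_ ?_
      · have := hone _ (by omega) _ (ih hj hc hy)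
        rwa [show i + 1 + j = i + j + 1 by omega]
      · have := ih (by omega) hc (hone j hj y hy)
        rwa [show i + 1 + j = i + (j + 1) by omega]
    | zero => simp
    | add u v _ _ hu hv => rw [add_lie]; exact Submodule.add_mem _ hu hv
    | smul c u _ hu => rw [smul_lie]; exact Submodule.smul_mem _ _ hu

theorem lie_mem_tail
    (hb : ∀ k, 1 ≤ k → Submodule.span ℝ {v | ∃ x ∈ layer b 1, ∃ y ∈ layer b k, v = ⁅x, y⁆} =
      layer b (k + 1)) {n : ℕ} {x : 𝔤} (hx : x ∈ tail b n) (y : 𝔤) : ⁅x, y⁆ ∈ tail b (n + 1) := by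
  rw [← b.sum_repr x, ← b.sum_repr y, sum_lie]
  refine Submodule.sum_mem _ fun k _ => ?_
  rw [lie_sum]
  refine Submodule.sum_mem _ fun l _ => ?_
  rw [smul_lie, lie_smul]
  by_cases hk : (k.1 : ℕ) + 1 ≤ n
  · simp [hx k hk]
  · refine Submodule.smul_mem _ _ (Submodule.smul_mem _ _ ?_)
    exact layer_le_tail b (by omega)
      (lie_mem_layer hb (by omega) (by omega) (basis_mem_layer b k) (basis_mem_layer b l))

theorem lie_mem_tail'
    (hb : ∀ k, 1 ≤ k → Submodule.span ℝ {v | ∃ x ∈ layer b 1, ∃ y ∈ layer b k, v = ⁅x, y⁆} =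
      layer b (k + 1)) {n : ℕ} {x : 𝔤} (hx : x ∈ tail b n) (y : 𝔤) : ⁅y, x⁆ ∈ tail b (n + 1) := by
  rw [← lie_skew]
  exact Submodule.neg_mem _ (lie_mem_tail hb hx y)

theorem lie_sub_lie_mem_tail
    (hb : ∀ k, 1 ≤ k → Submodule.span ℝ {v | ∃ x ∈ layer b 1, ∃ y ∈ layer b k, v = ⁅x, y⁆} =
      layer b (k + 1)) {n : ℕ} {x x' y y' : 𝔤} (hx : x - x' ∈ tail b n) (hy : y - y' ∈ tail b n) :
    ⁅x, y⁆ - ⁅x', y'⁆ ∈ tail b (n + 1) := by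
  have : ⁅x, y⁆ - ⁅x', y'⁆ = ⁅x - x', y⁆ + ⁅x', y - y'⁆ := by simp
  rw [this]
  exact Submodule.add_mem _ (lie_mem_tail hb hx y) (lie_mem_tail' hb hy x')

theorem nestedBracket_sub_mem_tail
    (hb : ∀ k, 1 ≤ k → Submodule.span ℝ {v | ∃ x ∈ layer b 1, ∃ y ∈ layer b k, v = ⁅x, y⁆} =
      layer b (k + 1)) {n : ℕ} {x y : 𝔤} (L : List (𝔤 → 𝔤)) (hL : ∀ f ∈ L, f x - f y ∈ tail b n) :
    nestedBracket (L.map fun f => f x) - nestedBracket (L.map fun f => f y) ∈ tail b n ∧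
      (2 ≤ L.length →
        nestedBracket (L.map fun f => f x) - nestedBracket (L.map fun f => f y) ∈
          tail b (n + 1)) := by
  induction L with
  | nil => simp [nestedBracket]
  | cons f L ih =>
    cases L with
    | nil => simpa [nestedBracket] using hL f (by simp)
    | cons f' L =>
      have h : nestedBracket ((f :: f' :: L).map fun f => f x) -
          nestedBracket ((f :: f' :: L).map fun f => f y) ∈ tail b (n + 1) := by
        simp only [List.map_cons, nestedBracket]
        refine lie_sub_lie_mem_tail hb (hL f (by simp)) ?_
        simpa using (ih fun g hg => hL g (by simp [hg])).1
      exact ⟨tail_anti b (Nat.le_succ n) h, fun _ => h⟩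

/-- This is the triangularity: the linear part of the series is `a + x`, and any word of length at
least two has a bracket, which pushes differences one layer deeper. Hence a coordinate of `bch t a x
- x` depends only on the lower layers of `x`. -/
theorem bch_sub_mem_tail
    (hb : ∀ k, 1 ≤ k → Submodule.span ℝ {v | ∃ x ∈ layer b 1, ∃ y ∈ layer b k, v = ⁅x, y⁆} =
      layer b (k + 1)) {t : ℕ} (ht : 0 < t) {n : ℕ} (a : 𝔤) {x y : 𝔤} (hxy : x - y ∈ tail b n) :
    (bch t a x - x) - (bch t a y - y) ∈ tail b (n + 1) := by
  have hword : ∀ p : List (ℕ × ℕ), 2 ≤ (p.map fun q => q.1 + q.2).sum →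
      nestedBracket (bchWord a x p) - nestedBracket (bchWord a y p) ∈ tail b (n + 1) := by
    intro p hp
    rw [bchWord_eq_map, bchWord_eq_map]
    refine (nestedBracket_sub_mem_tail hb _ fun f hf => ?_).2 (by rwa [length_bchLetters])
    rcases eq_of_mem_bchLetters hf with rfl | rfl
    · simp
    · exact hxy
  rw [show (bch t a x - x) - (bch t a y - y) = (bch t a x - bch t a y) - (x - y) by abel]
  rw [bch, bch, ← Finset.sum_sub_distrib,
    ← Finset.add_sum_erase _ _ (Finset.mem_Icc.2 ⟨le_rfl, ht⟩), add_sub_right_comm]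
  refine Submodule.add_mem _ ?_ (Submodule.sum_mem _ fun k hk => ?_)
  · rw [← Finset.sum_sub_distrib]
    -- The index of the one-letter word `x`, with coefficient `1`; it cancels `x - y`.
    let p₀ : Fin 1 → Fin (t + 1) × Fin (t + 1) := fun _ => (0, ⟨1, by omega⟩)
    rw [← Finset.add_sum_erase _ _ (a := p₀)
      (by simpa [p₀] using ⟨Nat.one_pos, ht⟩), add_sub_right_comm]
    refine Submodule.add_mem _ ?_ (Submodule.sum_mem _ fun p hp => ?_)
    · simp [p₀, bchWord, nestedBracket]
    · rw [← smul_sub]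
      refine Submodule.smul_mem _ _ ?_
      simp only [Finset.mem_erase, Finset.mem_filter, Finset.mem_univ, true_and] at hp
      by_cases h : 2 ≤ ((p 0).1 : ℕ) + ((p 0).2 : ℕ)
      · exact hword _ (by simpa using h)
      · have h1 := hp.2.1 0
        have h2 : ((p 0).1 : ℕ) = 1 ∧ ((p 0).2 : ℕ) = 0 := by
          by_contra hne
          refine hp.1 (funext fun i => ?_)
          rw [Subsingleton.elim i 0]
          refine Prod.ext (Fin.ext ?_) (Fin.ext ?_)
          · simp only [p₀, Fin.val_zero]; omega
          · simp only [p₀]; omega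
        simp [bchWord, h2.1, h2.2]
  · rw [← Finset.sum_sub_distrib]
    refine Submodule.sum_mem _ fun p hp => ?_
    rw [← smul_sub]
    refine Submodule.smul_mem _ _ (hword _ ?_)
    simp only [Finset.mem_filter, Finset.mem_univ, true_and] at hp
    have hk2 : 2 ≤ k := by
      have h1 := Finset.ne_of_mem_erase hk
      have h2 := (Finset.mem_Icc.1 (Finset.mem_of_mem_erase hk)).1
      omega
    rw [List.map_ofFn, List.sum_ofFn]
    calc 2 ≤ ∑ _i : Fin k, 1 := by simpa using hk2
      _ ≤ _ := Finset.sum_le_sum fun i _ => hp.1 i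

/-- In coordinates a bracket is bilinear, with the structure constants of the basis as coefficients.
-/
theorem measurable_repr_nestedBracket {T : Type*} [MeasurableSpace T] (L : List (T → 𝔤))
    (hL : ∀ f ∈ L, ∀ q, Measurable fun t => b.repr (f t) q) (q) :
    Measurable fun t => b.repr (nestedBracket (L.map fun f => f t)) q := by
  induction L generalizing q with
  | nil => simp [nestedBracket]
  | cons f L ih =>
    cases L with
    | nil => simpa [nestedBracket] using hL f (by simp) q
    | cons f' L =>
      have h : ∀ t, b.repr (nestedBracket ((f :: f' :: L).map fun f => f t)) q =
          ∑ k, ∑ l, b.repr (f t) k *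
            (b.repr (nestedBracket ((f' :: L).map fun f => f t)) l * b.repr ⁅b k, b l⁆ q) := by
        intro t
        simp only [List.map_cons, nestedBracket]
        conv_lhs => rw [← b.sum_repr (f t), ← b.sum_repr (nestedBracket (f' t :: _)),
          sum_lie]
        simp only [lie_sum, smul_lie, lie_smul, map_sum, map_smul, Finsupp.coe_finsetSum,
          Finset.sum_apply, Finsupp.smul_apply, smul_eq_mul]
        simp [mul_left_comm]
      simp only [h]
      refine Finset.measurable_fun_sum _ fun k _ => Finset.measurable_fun_sum _ fun l _ => ?_
      exact (hL f (by simp) k).mul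
        ((ih (fun g hg => hL g (by simp [hg])) l).mul measurable_const)

theorem measurable_repr_bch (b : Module.Basis ((i : Fin s) × Fin (dim i)) ℝ 𝔤) (t : ℕ) (a : 𝔤) (q) :
    Measurable fun z => b.repr (bch t a (b.equivFun.symm z)) q := by
  simp only [bch, map_sum, map_smul, Finsupp.coe_finsetSum, Finset.sum_apply, Finsupp.smul_apply,
    smul_eq_mul]
  refine Finset.measurable_fun_sum _ fun k _ => Finset.measurable_fun_sum _ fun p _ => ?_
  refine Measurable.const_mul ?_ _
  simp only [bchWord_eq_map]
  have := measurable_repr_nestedBracket (b := b)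
    ((bchLetters a (List.ofFn fun i => (((p i).1 : ℕ), ((p i).2 : ℕ)))).map
      fun f z => f (b.equivFun.symm z)) ?_ q
  · simpa [Function.comp_def] using this
  · intro f hf r
    obtain ⟨g, hg, rfl⟩ := List.mem_map.1 hf
    rcases eq_of_mem_bchLetters hg with rfl | rfl
    · exact measurable_const (a := b.repr a r)
    · have : ∀ z : ((i : Fin s) × Fin (dim i)) → ℝ, b.repr (id (b.equivFun.symm z)) r = z r :=
        fun z => by rw [id, ← b.equivFun_apply, LinearEquiv.apply_symm_apply]
      simp only [this]
      exact measurable_pi_apply r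

/-- Left translations preserve the Lebesgue measure in the coordinates of an adapted basis. -/
theorem measurePreserving_bch
    (hb : ∀ k, 1 ≤ k → Submodule.span ℝ {v | ∃ x ∈ layer b 1, ∃ y ∈ layer b k, v = ⁅x, y⁆} =
      layer b (k + 1)) {t : ℕ} (ht : 0 < t) (a : 𝔤) :
    MeasurePreserving (fun z => b.equivFun (bch t a (b.equivFun.symm z))) volume volume := by
  have hmeas : Measurable fun z => b.equivFun (bch t a (b.equivFun.symm z)) :=
    measurable_pi_lambda _ fun q => measurable_repr_bch b t a q
  have := measurePreserving_of_triangular (fun q : (i : Fin s) × Fin (dim i) => (q.1 : ℕ))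
    (f := fun z => b.equivFun (bch t a (b.equivFun.symm z)) - z) (hmeas.sub measurable_id) ?_
  · simpa using this
  · intro k x y hxy
    have h := bch_sub_mem_tail hb ht (n := k.1) a (x := b.equivFun.symm x)
      (y := b.equivFun.symm y) (fun q hq => ?_) k le_rfl
    · rw [← b.equivFun_apply] at h
      simp only [map_sub, LinearEquiv.apply_symm_apply, Pi.sub_apply] at h
      exact sub_eq_zero.1 h
    · rw [← b.equivFun_apply, map_sub, LinearEquiv.apply_symm_apply, LinearEquiv.apply_symm_apply,
        Pi.sub_apply, hxy q (by omega), sub_self]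

end Filtration

/-! ### Volume of the balls of the box norm. -/

section Box

variable {𝔤 : Type*} [LieRing 𝔤] [LieAlgebra ℝ 𝔤] {s : ℕ} {dim : Fin s → ℕ}

/-- The coordinates of the points of box norm smaller than `r`. -/
def coordBall (b : Module.Basis ((i : Fin s) × Fin (dim i)) ℝ 𝔤) (ε : Fin s → ℝ) (r : ℝ) :
    Set (((i : Fin s) × Fin (dim i)) → ℝ) :=
  {z | boxNorm b ε (b.equivFun.symm z) < r}

variable (b : Module.Basis ((i : Fin s) × Fin (dim i)) ℝ 𝔤) (ε : Fin s → ℝ)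

theorem layerNorm_equivFun_symm (i : Fin s) (z : ((i : Fin s) × Fin (dim i)) → ℝ) :
    layerNorm b i (b.equivFun.symm z) = Real.sqrt (∑ l : Fin (dim i), z ⟨i, l⟩ ^ 2) := by
  unfold layerNorm
  have : ∀ q, b.repr (b.equivFun.symm z) q = z q := fun q => by
    rw [← b.equivFun_apply, LinearEquiv.apply_symm_apply]
  simp only [this]

theorem mem_coordBall (hs : 0 < s) {r : ℝ} {z : ((i : Fin s) × Fin (dim i)) → ℝ} :
    z ∈ coordBall b ε r ↔ ∀ i : Fin s,
      ε i * Real.sqrt (∑ l : Fin (dim i), z ⟨i, l⟩ ^ 2) ^ (1 / (((i : ℕ) : ℝ) + 1)) < r := by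
  have : Nonempty (Fin s) := ⟨⟨0, hs⟩⟩
  simp only [coordBall, boxNorm, layerNorm_equivFun_symm, Set.mem_ofPred_eq]
  constructor
  · exact fun h i => (le_ciSup (Set.finite_range _).bddAbove i).trans_lt h
  · intro h
    obtain ⟨i, hi⟩ := exists_eq_ciSup_of_finite (f := fun i : Fin s =>
      ε i * Real.sqrt (∑ l : Fin (dim i), z ⟨i, l⟩ ^ 2) ^ (1 / (((i : ℕ) : ℝ) + 1)))
    rw [← hi]
    exact h i

theorem isOpen_coordBall (hs : 0 < s) (r : ℝ) : IsOpen (coordBall b ε r) := by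
  have : coordBall b ε r = ⋂ i : Fin s, {z |
      ε i * Real.sqrt (∑ l : Fin (dim i), z ⟨i, l⟩ ^ 2) ^ (1 / (((i : ℕ) : ℝ) + 1)) < r} := by
    ext z
    rw [mem_coordBall b ε hs]
    simp
  rw [this]
  refine isOpen_iInter_of_finite fun i => isOpen_lt (continuous_const.mul ?_) continuous_const
  exact Continuous.rpow_const (by fun_prop) fun z => Or.inr (by positivity)

theorem volume_coordBall_pos (hs : 0 < s) {r : ℝ} (hr : 0 < r) :
    0 < volume (coordBall b ε r) := by
  refine (isOpen_coordBall b ε hs r).measure_pos volume ⟨0, ?_⟩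
  rw [mem_coordBall b ε hs]
  intro i
  have : (1 : ℝ) / (((i : ℕ) : ℝ) + 1) ≠ 0 := by positivity
  simp [Real.zero_rpow, hr, Nat.cast_add_one_ne_zero]

theorem volume_coordBall_lt_top (hs : 0 < s) (hε : ∀ i, 0 < ε i) (r : ℝ) :
    volume (coordBall b ε r) < ⊤ := by
  refine Bornology.IsBounded.measure_lt_top ?_
  refine (Metric.isBounded_Icc (fun q : (i : Fin s) × Fin (dim i) => -(r / ε q.1) ^ ((q.1 : ℕ) + 1))
    (fun q => (r / ε q.1) ^ ((q.1 : ℕ) + 1))).subset fun z hz => ?_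
  have h : ∀ q, |z q| ≤ (r / ε q.1) ^ ((q.1 : ℕ) + 1) := by
    rintro ⟨i, l⟩
    have h1 := (mem_coordBall b ε hs).1 hz i
    set n := Real.sqrt (∑ l : Fin (dim i), z ⟨i, l⟩ ^ 2) with hn
    have hn0 : 0 ≤ n := Real.sqrt_nonneg _
    have h2 : |z ⟨i, l⟩| ≤ n := Real.abs_le_sqrt
      (Finset.single_le_sum (f := fun l => z ⟨i, l⟩ ^ 2) (fun l _ => sq_nonneg _)
        (Finset.mem_univ l))
    have h3 : n ^ (1 / (((i : ℕ) : ℝ) + 1)) ≤ r / ε i := by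
      rw [le_div_iff₀ (hε i), mul_comm]
      exact h1.le
    refine h2.trans ?_
    calc n = (n ^ (1 / (((i : ℕ) : ℝ) + 1))) ^ ((i : ℕ) + 1) := by
          rw [← Real.rpow_natCast, ← Real.rpow_mul hn0]
          push_cast
          rw [one_div_mul_cancel (by positivity), Real.rpow_one]
      _ ≤ _ := by gcongr
  exact ⟨fun q => (abs_le.1 (h q)).1, fun q => (abs_le.1 (h q)).2⟩

theorem volume_coordBall (hs : 0 < s) {r : ℝ} (hr : 0 < r) :
    volume (coordBall b ε r) =
      ENNReal.ofReal (r ^ (∑ i : Fin s, ((i : ℕ) + 1) * dim i)) * volume (coordBall b ε 1) := by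
  classical
  -- The dilation by `r⁻¹`: it is linear, divides the box norm by `r`, and its determinant is `r` to
  -- minus the homogeneous dimension.
  let d : ((i : Fin s) × Fin (dim i)) → ℝ := fun q => (r⁻¹) ^ ((q.1 : ℕ) + 1)
  have hpre : coordBall b ε r = Matrix.toLin' (Matrix.diagonal d) ⁻¹' coordBall b ε 1 := by
    ext z
    rw [Set.mem_preimage, mem_coordBall b ε hs, mem_coordBall b ε hs]
    refine forall_congr' fun i => ?_
    have h1 : ∀ l, (Matrix.toLin' (Matrix.diagonal d) z) ⟨i, l⟩ =
        (r⁻¹) ^ ((i : ℕ) + 1) * z ⟨i, l⟩ := fun l => by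
      simp [Matrix.mulVec_diagonal, d]
    simp only [h1, mul_pow, ← Finset.mul_sum]
    rw [Real.sqrt_mul (by positivity), Real.sqrt_sq (by positivity),
      Real.mul_rpow (by positivity) (by positivity), ← Real.rpow_natCast r⁻¹,
      ← Real.rpow_mul (by positivity)]
    push_cast
    rw [mul_one_div_cancel (by positivity), Real.rpow_one, mul_left_comm, inv_mul_lt_iff₀ hr,
      mul_one]
  have hdet : LinearMap.det (Matrix.toLin' (Matrix.diagonal d)) =
      (r ^ (∑ i : Fin s, ((i : ℕ) + 1) * dim i))⁻¹ := by
    rw [LinearMap.det_toLin', Matrix.det_diagonal, Fintype.prod_sigma]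
    simp only [d, Finset.prod_const, Finset.card_univ, Fintype.card_fin, ← pow_mul]
    rw [Finset.prod_pow_eq_pow_sum, inv_pow]
  rw [hpre, Measure.addHaar_preimage_linearMap _ (by rw [hdet]; positivity), hdet, inv_inv,
    abs_of_pos (by positivity)]

end Box

/-! ### Volume of metric balls and packing growth of the group. -/

section Group

variable {G 𝔤 : Type*} [Group G] [MetricSpace G] [LieRing 𝔤] [LieAlgebra ℝ 𝔤]
  (C : CarnotGroup G 𝔤)

/-- Exponential coordinates. -/
noncomputable def CarnotGroup.coord : G ≃ (((i : Fin C.step) × Fin (C.layerDim i)) → ℝ) :=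
  C.exp.symm.trans C.basis.equivFun.toEquiv

theorem CarnotGroup.coord_image_ball (p : G) (r : ℝ) :
    C.coord '' Metric.ball p r =
      (fun z => C.basis.equivFun (bch C.step (C.exp.symm p⁻¹) (C.basis.equivFun.symm z))) ⁻¹'
        coordBall C.basis C.eps r := by
  ext z
  obtain ⟨g, rfl⟩ := C.coord.surjective z
  rw [C.coord.injective.mem_set_image, Metric.mem_ball, dist_comm, C.dist_eq]
  have h : p⁻¹ * g = C.exp (bch C.step (C.exp.symm p⁻¹) (C.exp.symm g)) := by
    rw [← C.exp_mul_exp, Equiv.apply_symm_apply, Equiv.apply_symm_apply]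
  rw [h, Equiv.symm_apply_apply]
  simp [coordBall, CarnotGroup.coord]

theorem CarnotGroup.measurableSet_coord_image_ball (p : G) (r : ℝ) :
    MeasurableSet (C.coord '' Metric.ball p r) := by
  rw [C.coord_image_ball]
  exact (measurePreserving_bch C.lie_layer C.step_pos _).measurable
    (isOpen_coordBall _ _ C.step_pos r).measurableSet

theorem CarnotGroup.volume_coord_image_ball (p : G) {r : ℝ} (hr : 0 < r) :
    volume (C.coord '' Metric.ball p r) =
      ENNReal.ofReal (r ^ C.homDim) * volume (coordBall C.basis C.eps 1) := by
  rw [C.coord_image_ball, (measurePreserving_bch C.lie_layer C.step_pos _).measure_preimage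
    (isOpen_coordBall _ _ C.step_pos r).measurableSet.nullMeasurableSet,
    volume_coordBall _ _ C.step_pos hr]
  rfl

/-- The balls of radius `r / 2` about the separated points are disjoint and lie in a ball of radius
`R + r / 2`; compare volumes in exponential coordinates. -/
theorem CarnotGroup.hasPackingGrowth : HasPackingGrowth G C.homDim := by
  intro T x R r hR hr hT hsep
  have hv0 := (volume_coordBall_pos C.basis C.eps C.step_pos one_pos).ne'
  have hv1 := (volume_coordBall_lt_top C.basis C.eps C.step_pos C.eps_pos 1).ne
  have hdisj : Set.PairwiseDisjoint (↑T) fun t => C.coord '' Metric.ball t (r / 2) := by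
    intro a ha b hb hab
    refine (Set.disjoint_image_iff C.coord.injective).2 (Metric.ball_disjoint_ball ?_)
    linarith [hsep a ha b hb hab]
  have h : (T.card : ℝ≥0∞) * (ENNReal.ofReal ((r / 2) ^ C.homDim) *
      volume (coordBall C.basis C.eps 1)) ≤
      ENNReal.ofReal ((R + r / 2) ^ C.homDim) * volume (coordBall C.basis C.eps 1) := by
    calc (T.card : ℝ≥0∞) * (ENNReal.ofReal ((r / 2) ^ C.homDim) *
          volume (coordBall C.basis C.eps 1))
        = ∑ t ∈ T, volume (C.coord '' Metric.ball t (r / 2)) := by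
          simp only [C.volume_coord_image_ball _ (half_pos hr), Finset.sum_const, nsmul_eq_mul]
      _ = volume (⋃ t ∈ T, C.coord '' Metric.ball t (r / 2)) :=
          (measure_biUnion_finset hdisj fun t _ => C.measurableSet_coord_image_ball t _).symm
      _ ≤ volume (C.coord '' Metric.ball x (R + r / 2)) := by
          refine measure_mono (Set.iUnion₂_subset fun t ht => Set.image_mono ?_)
          exact Metric.ball_subset_ball' (by linarith [hT t ht])
      _ = _ := C.volume_coord_image_ball x (by positivity)
  rw [← mul_assoc, ENNReal.mul_le_mul_iff_left hv0 hv1, ← ENNReal.ofReal_natCast,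
    ← ENNReal.ofReal_mul (by positivity), ENNReal.ofReal_le_ofReal_iff (by positivity)] at h
  exact h

theorem CarnotGroup.homDim_pos : 0 < C.homDim :=
  Finset.sum_pos (fun i _ => Nat.mul_pos (Nat.succ_pos _) (C.layerDim_pos i))
    ⟨⟨0, C.step_pos⟩, Finset.mem_univ _⟩

end Group

/-! ### Comparison of the exponent with the dimension. -/

section Exponent

/-- The exponent of an upper regular measure is at most the dimension of the space. -/
theorem HasPackingGrowth.exponent_le {X : Type*} [MetricSpace X] [MeasurableSpace X] {Q : ℕ}
    (hX : HasPackingGrowth X Q) {φ : Measure X} {E : Set X} (hE : Bornology.IsBounded E)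
    (hφE : 0 < φ E) {m : ℝ} {ξ τ : ℕ} (hτ : 0 < τ) (hreg : ∀ x ∈ E, UpperRegularAt φ m ξ τ x) :
    m ≤ Q := by
  by_contra! hm
  obtain ⟨x₀, hx₀⟩ : E.Nonempty := nonempty_of_measure_ne_zero hφE.ne'
  obtain ⟨R, hR, hER⟩ := hE.subset_ball_lt 0 x₀
  -- An `r`-net of `E` has at most a constant times `r ^ (-Q)` points, and each ball has measure at
  -- most `ξ * r ^ m`. If `m > Q`, letting `r → 0` gives `φ E = 0`.
  have hbound : ∀ r : ℝ, 0 < r → r < min 1 (1 / (τ : ℝ)) →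
      φ E ≤ ENNReal.ofReal ((2 * R + 1) ^ Q * ξ * r ^ (m - Q)) := by
    intro r hr hr1
    obtain ⟨T, hTE, hTsep, hTnet⟩ := hX.exists_net hE hr
    have hcard := hX T x₀ R r hR hr (fun a ha => hER (hTE ha)) hTsep
    have hcard' : (T.card : ℝ) * r ^ Q ≤ (2 * R + 1) ^ Q := by
      calc (T.card : ℝ) * r ^ Q = 2 ^ Q * (T.card * (r / 2) ^ Q) := by
            rw [mul_left_comm, ← mul_pow]; ring_nf
        _ ≤ 2 ^ Q * (R + r / 2) ^ Q := by gcongr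
        _ = (2 * R + r) ^ Q := by rw [← mul_pow]; ring_nf
        _ ≤ _ := by
          have := hr1.trans_le (min_le_left _ _)
          gcongr
    calc φ E ≤ φ (⋃ t ∈ T, Metric.ball t r) := by
          refine measure_mono fun x hx => ?_
          obtain ⟨t, ht, hxt⟩ := hTnet x hx
          exact Set.mem_iUnion₂.2 ⟨t, ht, hxt⟩
      _ ≤ ∑ t ∈ T, φ (Metric.ball t r) := measure_biUnion_finset_le _ _
      _ ≤ ∑ t ∈ T, ENNReal.ofReal (ξ * r ^ m) := Finset.sum_le_sum fun t ht =>
          hreg t (hTE ht) r hr (hr1.trans_le (min_le_right _ _))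
      _ = ENNReal.ofReal (T.card * (ξ * r ^ m)) := by
          rw [Finset.sum_const, nsmul_eq_mul,
            ENNReal.ofReal_mul (p := (T.card : ℝ)) (by positivity), ENNReal.ofReal_natCast]
      _ ≤ _ := by
          refine ENNReal.ofReal_le_ofReal ?_
          have : r ^ m = r ^ Q * r ^ (m - Q) := by
            rw [← Real.rpow_natCast, ← Real.rpow_add hr]; ring_nf
          calc (T.card : ℝ) * (ξ * r ^ m) = (T.card * r ^ Q) * ξ * r ^ (m - Q) := by
                rw [this]; ring
            _ ≤ _ := by gcongr
  have hlim : Tendsto (fun r : ℝ => ENNReal.ofReal ((2 * R + 1) ^ Q * ξ * r ^ (m - Q)))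
      (𝓝[>] 0) (𝓝 0) := by
    have h1 : Tendsto (fun r : ℝ => (2 * R + 1) ^ Q * ξ * r ^ (m - Q)) (𝓝[>] 0) (𝓝 0) := by
      have h2 := (Real.continuousAt_rpow_const 0 (m - Q) (Or.inr (by linarith))).tendsto
      rw [Real.zero_rpow (by linarith)] at h2
      simpa using (h2.mono_left nhdsWithin_le_nhds).const_mul ((2 * R + 1) ^ Q * (ξ : ℝ))
    simpa using ENNReal.tendsto_ofReal h1
  refine hφE.not_ge (ge_of_tendsto hlim ?_)
  have hpos : 0 < min 1 (1 / (τ : ℝ)) := by positivity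
  filter_upwards [Ioo_mem_nhdsGT hpos] with r hr using hbound r hr.1 hr.2

end Exponent

/-! ### Numerical bounds for the constants. -/

section Constants

theorem zeta_pos (Q : ℕ) {ξ : ℕ} (hξ : 0 < ξ) : 0 < zeta Q ξ := by
  unfold zeta
  positivity

theorem zeta_le {Q ξ : ℕ} (hQ : 0 < Q) (hξ : 0 < ξ) : zeta Q ξ ≤ 1 / 96 := by
  have h1 : (1 : ℝ) ≤ ξ := by exact_mod_cast hξ
  have h2 : (96 : ℝ) ≤ 2 ^ (50 * Q) :=
    (by norm_num : (96 : ℝ) ≤ 2 ^ 7).trans (pow_le_pow_right₀ (by norm_num) (by omega))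
  unfold zeta
  calc ((2 : ℝ) ^ (50 * Q))⁻¹ * ((ξ : ℝ) ^ 2)⁻¹ ≤ 96⁻¹ * 1 := by
        gcongr
        exact inv_le_one_of_one_le₀ (one_le_pow₀ h1)
    _ = _ := by norm_num

theorem inv_two_pow_bigN_le {Q ξ : ℕ} (hQ : 0 < Q) (hξ : 0 < ξ) :
    16 * ((2 : ℝ) ^ bigN Q ξ)⁻¹ ≤ zeta Q ξ ^ 2 := by
  have hz := zeta_pos Q hξ
  have hlog : Real.log (zeta Q ξ) ≤ 0 :=
    Real.log_nonpos hz.le ((zeta_le hQ hξ).trans (by norm_num))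
  have h1 : -4 * Real.log (zeta Q ξ) < ⌊-4 * Real.log (zeta Q ξ)⌋₊ + 1 := Nat.lt_floor_add_one _
  -- In logarithms, `4 * log 2 > 2` handles `ζ ^ 2`, and the summand `40` covers both the `16` and
  -- the rounding.
  have h2 : (16 : ℝ) * (zeta Q ξ ^ 2)⁻¹ ≤ 2 ^ bigN Q ξ := by
    rw [← Real.log_le_log_iff (by positivity) (by positivity),
      Real.log_mul (by norm_num) (by positivity), Real.log_inv, Real.log_pow, Real.log_pow,
      show (16 : ℝ) = 2 ^ 4 by norm_num, Real.log_pow]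
    have h3 := Real.log_two_gt_d9
    unfold bigN
    push_cast
    nlinarith
  rw [← div_eq_mul_inv, div_le_iff₀ (by positivity)] at h2 ⊢
  linarith

theorem scale_pos (Q ξ : ℕ) {τ : ℕ} (hτ : 0 < τ) (j : ℕ) : 0 < scale Q ξ τ j := by
  unfold scale
  positivity

theorem scale_succ (Q ξ τ j : ℕ) :
    scale Q ξ τ (j + 1) = ((2 : ℝ) ^ bigN Q ξ)⁻¹ * scale Q ξ τ j := by
  unfold scale
  rw [mul_add, mul_one, pow_add, mul_inv]
  ring

theorem scale_lt (Q ξ : ℕ) {τ j : ℕ} (hτ : 0 < τ) (hj : 1 ≤ j) :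
    32 * scale Q ξ τ j < 1 / τ := by
  -- This needs `j ≥ 1`: at `j = 0` the scale is `1 / τ`, outside the range of the density bounds.
  have h1 : (2 : ℝ) ^ 6 ≤ 2 ^ (bigN Q ξ * j) := by
    refine pow_le_pow_right₀ (by norm_num) ?_
    have : 40 ≤ bigN Q ξ := Nat.le_add_left _ _
    nlinarith
  unfold scale
  rw [← mul_div_assoc, div_lt_div_iff_of_pos_right (by positivity), ← div_eq_mul_inv,
    div_lt_one (by positivity)]
  linarith

end Constants

end Carnot

/-! ### The cubes of the theorem, with `l` the given scale. -/

theorem theoremA3 {G 𝔤 : Type*} [Group G] [MetricSpace G] [LieRing 𝔤] [LieAlgebra ℝ 𝔤]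
    [MeasurableSpace G] [BorelSpace G] (C : Carnot.CarnotGroup G 𝔤)
    (m : ℝ) (hm : 0 < m)
    (φ : Measure G) [φ.Regular] (K : Set G) (hK : IsCompact K) (hφK : φ Kᶜ = 0)
    (hdens : ∀ᵐ x ∂φ, 0 < Carnot.lowerDensity φ m x ∧ Carnot.upperDensity φ m x < ⊤)
    (ξ τ : ℕ) (hξ : 0 < ξ) (hτ : 0 < τ)
    (hE : 0 < φ (Carnot.regularSet φ K m ξ τ)) :
    ∃ Δ : ℕ → Set (Set G),
      (∀ j, 1 ≤ j → Carnot.IsPartitionOf (Δ j) K ∧ ∀ Q ∈ Δ j, MeasurableSet Q) ∧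
      -- nestedness
      (∀ j j', 1 ≤ j → j ≤ j' → ∀ Q ∈ Δ j, ∀ Q' ∈ Δ j', Q' ⊆ Q ∨ Disjoint Q Q') ∧
      -- diameter
      (∀ j, 1 ≤ j → ∀ Q ∈ Δ j,
        Metric.ediam Q ≤ ENNReal.ofReal (2 ^ 5 * Carnot.scale C.homDim ξ τ j)) ∧
      -- measure of the cubes that meet the regular set
      (∀ j, 1 ≤ j → ∀ Q ∈ Δ j, (Q ∩ Carnot.regularSet φ K m ξ τ).Nonempty →
        ENNReal.ofReal ((Carnot.cubeConst C.homDim ξ)⁻¹ * Carnot.scale C.homDim ξ τ j ^ m) ≤ φ Q ∧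
        φ Q ≤ ENNReal.ofReal (Carnot.cubeConst C.homDim ξ * Carnot.scale C.homDim ξ τ j ^ m)) ∧
      -- small boundary layers, for the cubes that contain an upper regular point
      -- (in particular for those that meet the regular set)
      (∀ j, 1 ≤ j → ∀ Q ∈ Δ j, (∃ x ∈ Q, Carnot.UpperRegularAt φ m ξ τ x) →
        φ (Carnot.boundaryLayer K Q
            (Carnot.zeta C.homDim ξ ^ 2 * Carnot.scale C.homDim ξ τ j)) ≤
          ENNReal.ofReal (Carnot.cubeConst C.homDim ξ * Carnot.zeta C.homDim ξ *
            Carnot.scale C.homDim ξ τ j ^ m)) ∧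
      -- interior balls of the cubes that meet the regular set
      (∀ j, 1 ≤ j → ∀ Q ∈ Δ j, (Q ∩ Carnot.regularSet φ K m ξ τ).Nonempty →
        ∃ c ∈ K, Metric.ball c
          (Carnot.zeta C.homDim ξ ^ 2 * Carnot.scale C.homDim ξ τ j / 2) ∩ K ⊆ Q) := by
  have hQ := C.homDim_pos
  have hX := C.hasPackingGrowth
  set Q := C.homDim
  set E := Carnot.regularSet φ K m ξ τ with hEdef
  have hEK : E ⊆ K := fun x hx => hx.1
  have hmQ : m ≤ Q := hX.exponent_le (hK.isBounded.subset hEK) hE hτ fun x hx => hx.2.2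
  have hz := Carnot.zeta_pos Q hξ
  have hl := Carnot.scale_pos Q ξ hτ
  have hξ0 : (0 : ℝ) < ξ := by exact_mod_cast hξ
  have hp32 : (32 : ℝ) ^ m ≤ 32 ^ Q := by
    rw [← Real.rpow_natCast]
    exact Real.rpow_le_rpow_of_exponent_le (by norm_num) hmQ
  have hp8 : (8 : ℝ) ^ m ≤ 8 ^ Q := by
    rw [← Real.rpow_natCast]
    exact Real.rpow_le_rpow_of_exponent_le (by norm_num) hmQ
  have hupper : ∀ j, 1 ≤ j → ∀ x, Carnot.UpperRegularAt φ m ξ τ x →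
      φ (Metric.ball x (32 * Carnot.scale Q ξ τ j)) ≤
        ENNReal.ofReal (ξ * (32 ^ Q * Carnot.scale Q ξ τ j ^ m)) := by
    intro j hj x hx
    refine (hx _ (by linarith [hl j]) (Carnot.scale_lt Q ξ hτ hj)).trans
      (ENNReal.ofReal_le_ofReal ?_)
    rw [Real.mul_rpow (by norm_num) (hl j).le]
    have := (hl j).le
    gcongr
  obtain ⟨Δ, hpart, hnest, hdiam, hcore, hbdry⟩ := hX.exists_cubes φ hK.isBounded
    hK.measurableSet ((nonempty_of_measure_ne_zero hE.ne').mono hEK) hEK hl hz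
    (Carnot.zeta_le hQ hξ) (fun n => by
      rw [Carnot.scale_succ, ← mul_assoc]
      exact mul_le_mul_of_nonneg_right (Carnot.inv_two_pow_bigN_le hQ hξ) (hl n).le)
  refine ⟨Δ, fun j _ => hpart j, fun j j' _ => hnest j j', ?_, ?_, ?_, ?_⟩
  · intro j _ D hD
    refine Metric.ediam_le fun u hu v hv => ?_
    rw [edist_dist]
    exact ENNReal.ofReal_le_ofReal ((hdiam j D hD u hu v hv).trans (by linarith [hl j]))
  · intro j hj D hD hDE
    refine ⟨?_, ?_⟩
    · obtain ⟨c, hc, hcD⟩ := hcore j D hD hDE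
      have h1 : φ (Metric.ball c (Carnot.scale Q ξ τ j / 8)) ≤ φ D := by
        -- The core ball is inside the cube only within `K`, which carries all of `φ`.
        rw [← measure_inter_conull hφK]
        exact measure_mono hcD
      refine le_trans ?_ ((hc.2.1 _ (by linarith [hl j])
        (by linarith [Carnot.scale_lt Q ξ hτ hj, hl j])).trans h1)
      refine ENNReal.ofReal_le_ofReal ?_
      rw [Real.div_rpow (hl j).le (by norm_num), Carnot.cubeConst, mul_inv,
        mul_comm ((2 : ℝ) ^ _)⁻¹, mul_assoc, div_eq_inv_mul]
      have h8 : (8 : ℝ) ^ m ≤ 2 ^ (24 * Q) := hp8.trans (by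
        rw [pow_mul]
        gcongr
        norm_num)
      have := (hl j).le
      gcongr
    · obtain ⟨x, hxD, hxE⟩ := hDE
      have h1 : D ⊆ Metric.ball x (32 * Carnot.scale Q ξ τ j) := fun u hu =>
        (hdiam j D hD u hu x hxD).trans_lt (by linarith [hl j])
      refine (measure_mono h1).trans ((hupper j hj x hxE.2.2).trans
        (ENNReal.ofReal_le_ofReal ?_))
      have h32 : (32 : ℝ) ^ Q ≤ 2 ^ (24 * Q) := by
        rw [pow_mul]
        gcongr
        norm_num
      rw [Carnot.cubeConst, mul_comm ((2 : ℝ) ^ _), mul_assoc]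
      have := (hl j).le
      gcongr
  · rintro j hj D hD ⟨x, hxD, hx⟩
    refine (hbdry j D hD x hxD).trans ?_
    calc 6 * 64 ^ Q * (ENNReal.ofReal (Carnot.zeta Q ξ) *
          φ (Metric.ball x (32 * Carnot.scale Q ξ τ j)))
        ≤ ENNReal.ofReal (6 * 64 ^ Q) * (ENNReal.ofReal (Carnot.zeta Q ξ) *
          ENNReal.ofReal (ξ * (32 ^ Q * Carnot.scale Q ξ τ j ^ m))) := by
          rw [ENNReal.ofReal_mul (by norm_num), ENNReal.ofReal_pow (by norm_num),
            ENNReal.ofReal_ofNat, ENNReal.ofReal_ofNat]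
          gcongr
          exact hupper j hj x hx
      _ = ENNReal.ofReal (6 * 64 ^ Q * (Carnot.zeta Q ξ *
          (ξ * (32 ^ Q * Carnot.scale Q ξ τ j ^ m)))) := by
          rw [← ENNReal.ofReal_mul hz.le, ← ENNReal.ofReal_mul (by positivity)]
      _ ≤ _ := by
          refine ENNReal.ofReal_le_ofReal ?_
          -- As `Q ≥ 1`, the left side is at most `2 ^ (14 * Q)`.
          have h6 : (6 : ℝ) * 64 ^ Q * 32 ^ Q ≤ 2 ^ (24 * Q) := by
            calc (6 : ℝ) * 64 ^ Q * 32 ^ Q ≤ 8 ^ Q * 64 ^ Q * 32 ^ Q := by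
                  gcongr
                  exact (by norm_num : (6 : ℝ) ≤ 8 ^ 1).trans
                    (pow_le_pow_right₀ (by norm_num) hQ)
              _ = (8 * 64 * 32) ^ Q := by rw [mul_pow, mul_pow]
              _ ≤ (2 ^ 24) ^ Q := by gcongr; norm_num
              _ = _ := by rw [pow_mul]
          have hs : 0 ≤ Carnot.scale Q ξ τ j ^ m := Real.rpow_nonneg (hl j).le m
          rw [Carnot.cubeConst]
          calc _ = 6 * 64 ^ Q * 32 ^ Q * (ξ * Carnot.zeta Q ξ * Carnot.scale Q ξ τ j ^ m) := by
                ring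
            _ ≤ 2 ^ (24 * Q) * (ξ * Carnot.zeta Q ξ * Carnot.scale Q ξ τ j ^ m) := by gcongr
            _ = _ := by ring
  · intro j _ D hD hDE
    obtain ⟨c, hc, hcD⟩ := hcore j D hD hDE
    refine ⟨c, hEK hc, (Set.inter_subset_inter_left _ (Metric.ball_subset_ball ?_)).trans hcD⟩
    have h1 : Carnot.zeta Q ξ ^ 2 ≤ 1 / 4 := by
      have := Carnot.zeta_le hQ hξ
      nlinarith
    nlinarith [hl j]
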